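/- Let $M$ be a smooth surface, let $\mathcal A\subset TM\setminus 0$ be a conic sub-bundle (a non-empty open set, invariant under $y\mapsto\lambda y$ for $\lambda>0$, with projection onto all of $M$), and let $F:\mathcal A\to\mathbb R$ be a conic pseudo-Finsler metric: $F$ is smooth, positively $1$-homogeneous in $y$, and $g_{ij}=\tfrac12\dot\partial_i\dot\partial_jF^2$ is non-degenerate, where $\partial_i=\partial/\partial x^i$ and $\dot\partial_i=\partial/\partial y^i$. In local coordinates put $\varepsilon=\operatorname{sign}\det(g_{ij})$, $\ell_i=\dot\partial_iF$, $\ell^i=y^i/F$, $(m_1,m_2)=\sqrt{\varepsilon\det g}\,(-\ell^2,\ell^1)$, $(m^1,m^2)=\frac{\varepsilon}{\sqrt{\varepsilon\det g}}(-\ell_2,\ell_1)$. Let $C_{ijk}=\tfrac12\dot\partial_kg_{ij}$ be the Cartan tensor, $\mathcal I$ the main scalar, given by $FC_{ijk}=\mathcal I\,m_im_jm_k$, $G^i=\tfrac14g^{il}(y^k\partial_k\dot\partial_lF^2-\partial_lF^2)$ the coefficients of the geodesic spray $S=y^i\partial_i-2G^i\dot\partial_i$, and $\delta_i=\partial_i-(\dot\partial_iG^j)\dot\partial_j$.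 For a smooth function $f$ put $$f_{;2}=\varepsilon F(\dot\partial_if)m^i,\qquad f_{,1}=(\delta_if)\ell^i,\qquad f_{,2}=\varepsilon(\delta_if)m^i .$$ The metric $F$ is Landsberg if its Landsberg scalar $\mathcal J=S(\mathcal I)$ vanishes identically, and its $T$-tensor is given by $FT_{ijkh}=\mathcal I_{;2}\,m_im_jm_km_h$. Assume that $F$ is conic pseudo-Riemannian, i.e. $C_{ijk}=0$. Let $\phi$ be a smooth function on $\mathcal A$, positively $0$-homogeneous in $y$, with $$F^2\big(\dot\partial_i\dot\partial_j\phi+(\dot\partial_i\phi)(\dot\partial_j\phi)\big)m^im^j+\varepsilon\neq0,$$ and let $\overline F=e^{\phi}F$ be the corresponding anisotropic conformal change of $F$. Assume that $\phi_{;2}$ is horizontally constant, i.e. $\delta_i(\phi_{;2})=0$. Then, with derivatives of $\phi$ taken with respect to $F$ and with $\overline T$ the $T$-tensor of $\overline F$: 1. $\overline F$ is Landsberg if and only if every point of $\mathcal A$ has an open neighbourhood in $\mathcal A$ on which either $\overline T$ vanishes identically or $\phi_{;2}\,\phi_{,1}=\phi_{,2}$ holds identically. 2. Suppose moreover that the fibres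 $\mathcal A_x$, $x\in M$, are connected and that, for every $u\in\mathcal A$ and every $x\in M$, there is a horizontal curve of $F$ inside $\mathcal A$ from $u$ to a point of $\mathcal A_x$ (for instance $\mathcal A=TM\setminus 0$ with $M$ connected). Here a horizontal curve is a continuous, differentiable curve $[0,1]\to TM$, $t\mapsto(x(t),y(t))$, with $\dot y^j=-(\dot\partial_iG^j)\,\dot x^i$. Then $\overline F$ is Landsberg if and only if either $\overline T$ vanishes identically on $\mathcal A$ or $\phi_{;2}\,\phi_{,1}=\phi_{,2}$ holds on all of $\mathcal A$. -/

import Mathlib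

open scoped Manifold ContDiff

noncomputable section

namespace FinslerSurface

/-- The model plane `ℝ²`. -/
abbrev E2 : Type := EuclideanSpace ℝ (Fin 2)

/-! ### Calculus in local coordinates

A function on an open part of a tangent bundle of a surface is read in local coordinates as
`f x y` with `x = (x¹, x²)` and `y = (y¹, y²)`. -/

/-- `∂ᵢ f = ∂f/∂xⁱ`. -/
def dx (i : Fin 2) (f : E2 → E2 → ℝ) (x y : E2) : ℝ :=
  fderiv ℝ (fun x' => f x' y) x (EuclideanSpace.single i 1)

/-- `∂̇ᵢ f = ∂f/∂yⁱ`. -/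
def dy (i : Fin 2) (f : E2 → E2 → ℝ) (x y : E2) : ℝ :=
  fderiv ℝ (fun y' => f x y') y (EuclideanSpace.single i 1)

/-- The metric tensor `gᵢⱼ = ½ ∂̇ᵢ∂̇ⱼ F²`. -/
def metric (F : E2 → E2 → ℝ) (x y : E2) : Matrix (Fin 2) (Fin 2) ℝ :=
  Matrix.of fun i j => (1 / 2) * dy i (dy j fun x y => F x y ^ 2) x y

/-- The signature `ε = ±1`, the sign of `det (gᵢⱼ)`. -/
def eps (F : E2 → E2 → ℝ) (x y : E2) : ℝ := Real.sign (metric F x y).det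

/-- `ℓᵢ = ∂̇ᵢ F`. -/
def ellLow (F : E2 → E2 → ℝ) (i : Fin 2) (x y : E2) : ℝ := dy i F x y

/-- `ℓⁱ = yⁱ / F`. -/
def ellUp (F : E2 → E2 → ℝ) (i : Fin 2) (x y : E2) : ℝ := y i / F x y

/-- `(m₁, m₂) = √(ε det g) (-ℓ², ℓ¹)`. -/
def mLow (F : E2 → E2 → ℝ) (i : Fin 2) (x y : E2) : ℝ :=
  Real.sqrt (eps F x y * (metric F x y).det) * ![-ellUp F 1 x y, ellUp F 0 x y] i

/-- `(m¹, m²) = (ε / √(ε det g)) (-ℓ₂, ℓ₁)`. -/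
def mUp (F : E2 → E2 → ℝ) (i : Fin 2) (x y : E2) : ℝ :=
  eps F x y / Real.sqrt (eps F x y * (metric F x y).det) *
    ![-ellLow F 1 x y, ellLow F 0 x y] i

/-- The Cartan tensor `Cᵢⱼₖ = ½ ∂̇ₖ gᵢⱼ`. -/
def cartan (F : E2 → E2 → ℝ) (i j k : Fin 2) (x y : E2) : ℝ :=
  (1 / 2) * dy k (fun x y => metric F x y i j) x y

/-- The main scalar `𝓘`, determined by `F Cᵢⱼₖ = 𝓘 mᵢ mⱼ mₖ`; as `mᵢ mⁱ = ε`, this is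
`𝓘 = ε F Cᵢⱼₖ mⁱ mʲ mᵏ`. -/
def mainScalar (F : E2 → E2 → ℝ) (x y : E2) : ℝ :=
  eps F x y * F x y *
    ∑ i, ∑ j, ∑ k, cartan F i j k x y * mUp F i x y * mUp F j x y * mUp F k x y

/-- The coefficients `Gⁱ = ¼ gⁱˡ (yᵏ ∂ₖ ∂̇ₗ F² - ∂ₗ F²)` of the geodesic spray. -/
def sprayCoeff (F : E2 → E2 → ℝ) (i : Fin 2) (x y : E2) : ℝ :=
  (1 / 4) * ∑ l, (metric F x y)⁻¹ i l *
    ((∑ k, y k * dx k (dy l fun x y => F x y ^ 2) x y) - dx l (fun x y => F x y ^ 2) x y)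

/-- The geodesic spray `S = yⁱ ∂ᵢ - 2 Gⁱ ∂̇ᵢ`, as a derivation. -/
def spray (F f : E2 → E2 → ℝ) (x y : E2) : ℝ :=
  ∑ i, (y i * dx i f x y - 2 * sprayCoeff F i x y * dy i f x y)

/-- The coefficients `Gʲᵢ = ∂̇ᵢ Gʲ` of the Barthel connection. -/
def barthel (F : E2 → E2 → ℝ) (j i : Fin 2) (x y : E2) : ℝ := dy i (sprayCoeff F j) x y

/-- `δᵢ f = ∂ᵢ f - Gʲᵢ ∂̇ⱼ f`. -/
def delta (F : E2 → E2 → ℝ) (i : Fin 2) (f : E2 → E2 → ℝ) (x y : E2) : ℝ :=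
  dx i f x y - ∑ j, barthel F j i x y * dy j f x y

/-- The vertical scalar derivative `f_{;2} = ε F (∂̇ᵢ f) mⁱ`. -/
def vDer2 (F f : E2 → E2 → ℝ) (x y : E2) : ℝ :=
  eps F x y * F x y * ∑ i, dy i f x y * mUp F i x y

/-- The horizontal scalar derivative `f_{,1} = (δᵢ f) ℓⁱ`. -/
def hDer1 (F f : E2 → E2 → ℝ) (x y : E2) : ℝ := ∑ i, delta F i f x y * ellUp F i x y

/-- The horizontal scalar derivative `f_{,2} = ε (δᵢ f) mⁱ`. -/
def hDer2 (F f : E2 → E2 → ℝ) (x y : E2) : ℝ :=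
  eps F x y * ∑ i, delta F i f x y * mUp F i x y

/-- The `T`-tensor: `F Tᵢⱼₖₕ = 𝓘_{;2} mᵢ mⱼ mₖ mₕ`. -/
def tTensor (F : E2 → E2 → ℝ) (i j k h : Fin 2) (x y : E2) : ℝ :=
  vDer2 F (mainScalar F) x y * mLow F i x y * mLow F j x y * mLow F k x y * mLow F h x y / F x y

/-- The Landsberg scalar `𝓙 = S(𝓘)`. -/
def landsbergScalar (F : E2 → E2 → ℝ) (x y : E2) : ℝ := spray F (mainScalar F) x y

/-! ### Surfaces

Objects on the tangent bundle `TM` of a surface `M` are read in all charts `c` of the maximal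
smooth atlas. -/

variable {M : Type*} [TopologicalSpace M] [ChartedSpace E2 M] [IsManifold 𝓘(ℝ, E2) ∞ M]

/-- The point of `TM` with coordinates `(x, y)` in the chart of `TM` induced by `c`. -/
def ofCoord (c : OpenPartialHomeomorph M E2) (x y : E2) : TangentBundle 𝓘(ℝ, E2) M :=
  tangentMap 𝓘(ℝ, E2) 𝓘(ℝ, E2) c.symm ⟨x, y⟩

/-- The first two coordinates `(x¹, x²)` of a point of `TM` over the source of `c`. -/
def baseCoord (c : OpenPartialHomeomorph M E2) (u : TangentBundle 𝓘(ℝ, E2) M) : E2 := c u.proj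

/-- The last two coordinates `(y¹, y²)` of a point of `TM` over the source of `c`. -/
def fibreCoord (c : OpenPartialHomeomorph M E2) (u : TangentBundle 𝓘(ℝ, E2) M) : E2 :=
  mfderiv 𝓘(ℝ, E2) 𝓘(ℝ, E2) c u.proj u.2

/-- A function on `TM` in the coordinates induced by `c`. -/
def inChart (c : OpenPartialHomeomorph M E2) (f : TangentBundle 𝓘(ℝ, E2) M → ℝ) :
    E2 → E2 → ℝ :=
  fun x y => f (ofCoord c x y)

/-- `HoldsAt u P`: the coordinate condition `P c x y` holds at `u ∈ TM`, in every chart `c` of the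
maximal smooth atlas around the base point of `u`, where `(x, y)` are the coordinates of `u`. -/
def HoldsAt (u : TangentBundle 𝓘(ℝ, E2) M)
    (P : OpenPartialHomeomorph M E2 → E2 → E2 → Prop) : Prop :=
  ∀ c ∈ IsManifold.maximalAtlas 𝓘(ℝ, E2) ∞ M, ∀ x ∈ c.target, ∀ y : E2,
    ofCoord c x y = u → P c x y

/-- A conic sub-bundle `𝒜` of `TM`. -/
structure IsConicSubbundle (A : Set (TangentBundle 𝓘(ℝ, E2) M)) : Prop where
  isOpen : IsOpen A
  nonempty : A.Nonempty
  ne_zero : ∀ u ∈ A, u.2 ≠ 0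
  smul_mem : ∀ u ∈ A, ∀ t : ℝ, 0 < t →
    (⟨u.proj, t • u.2⟩ : TangentBundle 𝓘(ℝ, E2) M) ∈ A
  proj_surj : ∀ p : M, ∃ v : TangentSpace 𝓘(ℝ, E2) p,
    (⟨p, v⟩ : TangentBundle 𝓘(ℝ, E2) M) ∈ A

/-- `f` is smooth on `𝒜`. -/
def IsSmoothOn (A : Set (TangentBundle 𝓘(ℝ, E2) M)) (f : TangentBundle 𝓘(ℝ, E2) M → ℝ) : Prop :=
  ContMDiffOn 𝓘(ℝ, E2).tangent 𝓘(ℝ, ℝ) ∞ f A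

/-- `f` is `h(r)` on `𝒜`: positively homogeneous of degree `r` in the directional argument. -/
def IsHomogeneousOn (r : ℕ) (A : Set (TangentBundle 𝓘(ℝ, E2) M))
    (f : TangentBundle 𝓘(ℝ, E2) M → ℝ) : Prop :=
  ∀ u ∈ A, ∀ t : ℝ, 0 < t → f ⟨u.proj, t • u.2⟩ = t ^ r * f u

/-- `F` is a conic pseudo-Finsler metric with domain `𝒜`. -/
structure IsConicPseudoFinsler (A : Set (TangentBundle 𝓘(ℝ, E2) M))
    (F : TangentBundle 𝓘(ℝ, E2) M → ℝ) : Prop where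
  conic : IsConicSubbundle A
  smooth : IsSmoothOn A F
  homogeneous : IsHomogeneousOn 1 A F
  nondegenerate : ∀ u ∈ A, HoldsAt u fun c x y => (metric (inChart c F) x y).det ≠ 0

/-- `F` is a conic pseudo-Riemannian metric: a conic pseudo-Finsler metric with vanishing Cartan
tensor, that is, whose metric tensor does not vary with the directional argument. -/
structure IsConicPseudoRiemannian (A : Set (TangentBundle 𝓘(ℝ, E2) M))
    (F : TangentBundle 𝓘(ℝ, E2) M → ℝ) : Prop extends IsConicPseudoFinsler A F where
  cartan_eq_zero : ∀ u ∈ A, HoldsAt u fun c x y => ∀ i j k, cartan (inChart c F) i j k x y = 0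

/-- `φ` is the conformal factor of an anisotropic conformal change of `F` on `𝒜`. -/
structure IsAnisotropicConformalFactor (A : Set (TangentBundle 𝓘(ℝ, E2) M))
    (F φ : TangentBundle 𝓘(ℝ, E2) M → ℝ) : Prop where
  smooth : IsSmoothOn A φ
  homogeneous : IsHomogeneousOn 0 A φ
  nondegenerate : ∀ u ∈ A, HoldsAt u fun c x y =>
    inChart c F x y ^ 2 *
        (∑ i, ∑ j, (dy i (dy j (inChart c φ)) x y
            + dy i (inChart c φ) x y * dy j (inChart c φ) x y)
          * mUp (inChart c F) i x y * mUp (inChart c F) j x y)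
      + eps (inChart c F) x y ≠ 0

/-- The anisotropic conformal change `F̄ = e^φ F`. -/
def conformalChange (φ F : TangentBundle 𝓘(ℝ, E2) M → ℝ) : TangentBundle 𝓘(ℝ, E2) M → ℝ :=
  fun u => Real.exp (φ u) * F u

/-- `φ_{;2}` is horizontally constant on `𝒜`: `δᵢ(φ_{;2}) = 0`. (`φ_{;2}` depends on the chart
through its orientation only, by a sign.) -/
def VDer2HorizontallyConstant (A : Set (TangentBundle 𝓘(ℝ, E2) M))
    (F φ : TangentBundle 𝓘(ℝ, E2) M → ℝ) : Prop :=
  ∀ u ∈ A, HoldsAt u fun c x y =>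
    ∀ i, delta (inChart c F) i (vDer2 (inChart c F) (inChart c φ)) x y = 0

/-- `F` is Landsberg on `𝒜`: its Landsberg scalar vanishes identically. -/
def IsLandsberg (A : Set (TangentBundle 𝓘(ℝ, E2) M)) (F : TangentBundle 𝓘(ℝ, E2) M → ℝ) : Prop :=
  ∀ u ∈ A, HoldsAt u fun c x y => landsbergScalar (inChart c F) x y = 0

/-- The `T`-tensor of `F` vanishes identically on `B`. -/
def TTensorVanishesOn (B : Set (TangentBundle 𝓘(ℝ, E2) M))
    (F : TangentBundle 𝓘(ℝ, E2) M → ℝ) : Prop :=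
  ∀ u ∈ B, HoldsAt u fun c x y => ∀ i j k h, tTensor (inChart c F) i j k h x y = 0

/-- `φ_{;2} φ_{,1} = φ_{,2}` on `B`. -/
def ScalarDerivRelationOn (B : Set (TangentBundle 𝓘(ℝ, E2) M))
    (F φ : TangentBundle 𝓘(ℝ, E2) M → ℝ) : Prop :=
  ∀ u ∈ B, HoldsAt u fun c x y =>
    vDer2 (inChart c F) (inChart c φ) x y * hDer1 (inChart c F) (inChart c φ) x y
      = hDer2 (inChart c F) (inChart c φ) x y

/-- `γ : [0,1] → TM` is a horizontal curve of the Barthel connection of `F`: it is differentiable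
and satisfies `ẏʲ = -Gʲᵢ ẋⁱ` in coordinates. -/
def IsHorizontalCurve (F : TangentBundle 𝓘(ℝ, E2) M → ℝ)
    (γ : ℝ → TangentBundle 𝓘(ℝ, E2) M) : Prop :=
  ContinuousOn γ (Set.Icc 0 1) ∧
  ∀ t ∈ Set.Icc (0 : ℝ) 1, ∀ c ∈ IsManifold.maximalAtlas 𝓘(ℝ, E2) ∞ M,
    (γ t).proj ∈ c.source →
    ∃ x' y' : E2,
      HasDerivWithinAt (fun s => baseCoord c (γ s)) x' (Set.Icc 0 1) t ∧
      HasDerivWithinAt (fun s => fibreCoord c (γ s)) y' (Set.Icc 0 1) t ∧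
      ∀ j, y' j = -∑ i, barthel (inChart c F) j i (baseCoord c (γ t)) (fibreCoord c (γ t)) * x' i

/-- `𝒜` is horizontally connected: its fibres are connected, and from every point of `𝒜` every
fibre of `𝒜` can be reached along a horizontal curve that stays in `𝒜`. -/
def IsHorizontallyConnected (A : Set (TangentBundle 𝓘(ℝ, E2) M))
    (F : TangentBundle 𝓘(ℝ, E2) M → ℝ) : Prop :=
  (∀ p : M, IsConnected {v : TangentSpace 𝓘(ℝ, E2) p |
      (⟨p, v⟩ : TangentBundle 𝓘(ℝ, E2) M) ∈ A}) ∧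
  ∀ u ∈ A, ∀ p : M, ∃ γ : ℝ → TangentBundle 𝓘(ℝ, E2) M,
    IsHorizontalCurve F γ ∧ (∀ t ∈ Set.Icc (0 : ℝ) 1, γ t ∈ A) ∧ γ 0 = u ∧ (γ 1).proj = p

end FinslerSurface

end

/-!
Write `F̄ = e^φ F`, let `Ī` be its main scalar, `Ī_{;2}` the derivative of `Ī` taken with respect to
`F̄`, and `cₖ = δₖφ`. All computations take place in coordinates `(x, y)` of the tangent bundle.

Since `F` is pseudo-Riemannian, its connection coefficients `Gʲₖ = Γʲₖₗ(x) yˡ` are linear in `y`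
(`CoordRiemannian.barthel_eq`), and `δₖF = 0`. Hence `δₖ` commutes with the vertical derivatives up
to the terms a tensor index contributes (`lift_dy`). Applied to `φ_{;2}`, this turns
`δₖ(φ_{;2}) = 0` into `∂̇ᵢcₖ = 0` (`CoordChange.vConst_delta_factor`). So `δₖF̄ = cₖF̄` with a factor
that does not vary along the fibres: `δₖ` acts on the metric function, the metric tensor and the
Cartan tensor of `F̄` as an infinitesimal homothety. The main scalar and the operator
`f ↦ f_{;2}` of `F̄` have weight zero under homotheties, and therefore `δₖĪ = 0` and
`δₖ(Ī_{;2}) = 0` (`HasWeight.lift_mainScalar`, `HasWeight.lift_vDer2`). The same weight count for the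
Euler field gives the homogeneity of `Ī`.

Because of `δₖĪ = 0`, the Landsberg scalar `S̄(Ī)` is `-2 (Ḡʲ - Gʲ) ∂̇ⱼĪ`, and computing the
difference of the sprays shows that it is, up to a factor without zeros, the product of `Ī_{;2}` and
`φ_{;2} φ_{,1} - φ_{,2}` (`CoordChange.landsberg_iff`). Thus `F̄` is Landsberg if and only if at each
point one of the two factors vanishes, and it remains to see that the same factor does so locally,
respectively globally. Two facts are used.

* If the second factor vanishes on an open set, differentiating it along the fibres shows that
  `(c₂, -c₁)` is in the kernel of the metric tensor of `F̄`; so `c = 0` there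
  (`CoordChange.delta_factor_eq_zero`). As `cₖ` is constant along connected parts of the fibres, one
  point with `Ī_{;2} ≠ 0` forces the relation on a whole connected part of its fibre
  (`ChangeData.relation_of_tFun_ne_zero`).
* `Ī_{;2}` is independent of the chart (`tScalar_fibreChange`) and constant along horizontal curves
  (`ChangeData.tFun_horizontal`), so `Ī_{;2} ≠ 0` is carried to other fibres: to all nearby ones by
  the Picard–Lindelöf theorem (`CoordChange.exists_tScalar_eq`), and to all fibres under the
  connectedness hypothesis.
-/

noncomputable section

namespace FinslerSurface

/-! ### Calculus on open sets of the coordinate tangent bundle -/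

/-- Smoothness on `Ω` of a function of the coordinates `(x, y)`. -/
def Sm (Ω : Set (E2 × E2)) (f : E2 → E2 → ℝ) : Prop :=
  ContDiffOn ℝ ∞ (fun z : E2 × E2 => f z.1 z.2) Ω

/-- The derivative of `f` at `(x, y)` along the vector `w` of the total space. -/
def D (w : E2 × E2) (f : E2 → E2 → ℝ) (x y : E2) : ℝ :=
  fderiv ℝ (fun z : E2 × E2 => f z.1 z.2) (x, y) w

/-- The `i`-th vector of the standard basis of the plane. -/
abbrev e (i : Fin 2) : E2 := EuclideanSpace.single i 1

section Calculus

variable {Ω : Set (E2 × E2)} {f g : E2 → E2 → ℝ} {x y : E2}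

lemma Sm.differentiableAt (hΩ : IsOpen Ω) (hf : Sm Ω f) (h : (x, y) ∈ Ω) :
    DifferentiableAt ℝ (fun z : E2 × E2 => f z.1 z.2) (x, y) :=
  (hf.contDiffAt (hΩ.mem_nhds h)).differentiableAt (by simp)

lemma Sm.add (hf : Sm Ω f) (hg : Sm Ω g) : Sm Ω (fun x y => f x y + g x y) := ContDiffOn.add hf hg
lemma Sm.sub (hf : Sm Ω f) (hg : Sm Ω g) : Sm Ω (fun x y => f x y - g x y) := ContDiffOn.sub hf hg
lemma Sm.neg (hf : Sm Ω f) : Sm Ω (fun x y => -f x y) := ContDiffOn.neg hf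
lemma Sm.mul (hf : Sm Ω f) (hg : Sm Ω g) : Sm Ω (fun x y => f x y * g x y) := ContDiffOn.mul hf hg
lemma Sm.pow (hf : Sm Ω f) (n : ℕ) : Sm Ω (fun x y => f x y ^ n) := ContDiffOn.pow hf n
lemma Sm.const (a : ℝ) : Sm Ω (fun _ _ => a) := contDiffOn_const
lemma Sm.exp (hf : Sm Ω f) : Sm Ω (fun x y => Real.exp (f x y)) := ContDiffOn.exp hf
lemma Sm.sqrt (hf : Sm Ω f) (h0 : ∀ x y, (x, y) ∈ Ω → f x y ≠ 0) :
    Sm Ω (fun x y => Real.sqrt (f x y)) := ContDiffOn.sqrt hf fun z hz => h0 z.1 z.2 hz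
lemma Sm.abs (hf : Sm Ω f) (h0 : ∀ x y, (x, y) ∈ Ω → f x y ≠ 0) :
    Sm Ω (fun x y => |f x y|) := ContDiffOn.abs hf fun z hz => h0 z.1 z.2 hz
lemma Sm.sum {ι : Type*} [Fintype ι] {f : ι → E2 → E2 → ℝ} (hf : ∀ i, Sm Ω (f i)) :
    Sm Ω (fun x y => ∑ i, f i x y) := ContDiffOn.sum fun i _ => hf i

lemma Sm.congr (hf : Sm Ω f) (h : ∀ x y, (x, y) ∈ Ω → g x y = f x y) : Sm Ω g :=
  ContDiffOn.congr hf fun z hz => h z.1 z.2 hz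

lemma sm_coord (i : Fin 2) : Sm Ω (fun _ y => y i) := by
  unfold Sm
  exact (contDiff_piLp_apply (𝕜 := ℝ) (p := 2)).comp_contDiffOn contDiffOn_snd

lemma Sm.D (hΩ : IsOpen Ω) (hf : Sm Ω f) (w : E2 × E2) : Sm Ω (D w f) := by
  have : ContDiffOn ℝ ∞ (fderiv ℝ (fun z : E2 × E2 => f z.1 z.2)) Ω :=
    hf.fderiv_of_isOpen hΩ (by simp)
  exact this.clm_apply contDiffOn_const

/-- `f` is differentiable at `(x, y)` and its derivative there along `w` is `a`. -/
structure HasD (w : E2 × E2) (f : E2 → E2 → ℝ) (x y : E2) (a : ℝ) : Prop where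
  diff : DifferentiableAt ℝ (fun z : E2 × E2 => f z.1 z.2) (x, y)
  eq : D w f x y = a

lemma Sm.hasD (hΩ : IsOpen Ω) (hf : Sm Ω f) (h : (x, y) ∈ Ω) (w : E2 × E2) :
    HasD w f x y (FinslerSurface.D w f x y) := ⟨hf.differentiableAt hΩ h, rfl⟩

lemma Sm.hasD_of (hΩ : IsOpen Ω) (hf : Sm Ω f) (h : (x, y) ∈ Ω) {w : E2 × E2} {a : ℝ}
    (ha : FinslerSurface.D w f x y = a) : HasD w f x y a := ⟨hf.differentiableAt hΩ h, ha⟩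

section HasD

variable {w : E2 × E2} {a b : ℝ}

lemma HasD.add (hf : HasD w f x y a) (hg : HasD w g x y b) :
    HasD w (fun x y => f x y + g x y) x y (a + b) :=
  ⟨hf.diff.add hg.diff, by rw [← hf.eq, ← hg.eq, D, fderiv_fun_add hf.diff hg.diff]; rfl⟩

lemma HasD.sub (hf : HasD w f x y a) (hg : HasD w g x y b) :
    HasD w (fun x y => f x y - g x y) x y (a - b) :=
  ⟨hf.diff.sub hg.diff, by rw [← hf.eq, ← hg.eq, D, fderiv_fun_sub hf.diff hg.diff]; rfl⟩

lemma HasD.neg (hf : HasD w f x y a) : HasD w (fun x y => -f x y) x y (-a) :=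
  ⟨hf.diff.neg, by rw [← hf.eq, D, fderiv_fun_neg]; rfl⟩

lemma HasD.mul (hf : HasD w f x y a) (hg : HasD w g x y b) :
    HasD w (fun x y => f x y * g x y) x y (a * g x y + f x y * b) :=
  ⟨hf.diff.mul hg.diff, by
    rw [← hf.eq, ← hg.eq, D, fderiv_fun_mul hf.diff hg.diff]; simp [D]; ring⟩

lemma HasD.comp {u : ℝ → ℝ} {u' : ℝ} (hf : HasD w f x y a) (hu : HasDerivAt u u' (f x y)) :
    HasD w (fun x y => u (f x y)) x y (u' * a) := by
  have h1 := HasDerivAt.comp_hasFDerivAt (x, y) (f := fun z : E2 × E2 => f z.1 z.2) hu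
    hf.diff.hasFDerivAt
  refine ⟨h1.differentiableAt, ?_⟩
  rw [← hf.eq, D, show (fun z : E2 × E2 => u (f z.1 z.2)) = u ∘ (fun z : E2 × E2 => f z.1 z.2)
    from rfl, h1.fderiv]
  simp [D]

lemma HasD.const (c : ℝ) : HasD w (fun _ _ => c) x y 0 := ⟨differentiableAt_const c, by simp [D]⟩

lemma HasD.pow_two (hf : HasD w f x y a) : HasD w (fun x y => f x y ^ 2) x y (2 * f x y * a) := by
  simpa using hf.comp (u := fun t => t ^ 2) (hasDerivAt_pow 2 (f x y))

lemma HasD.inv (hf : HasD w f x y a) (h0 : f x y ≠ 0) :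
    HasD w (fun x y => (f x y)⁻¹) x y (-a * (f x y)⁻¹ * (f x y)⁻¹) := by
  convert hf.comp (u := fun t => t⁻¹) (hasDerivAt_inv h0) using 1
  field_simp

lemma HasD.sum {ι : Type*} [Fintype ι] {f : ι → E2 → E2 → ℝ} {a : ι → ℝ}
    (hf : ∀ i, HasD w (f i) x y (a i)) : HasD w (fun x y => ∑ i, f i x y) x y (∑ i, a i) := by
  refine ⟨DifferentiableAt.fun_sum fun i _ => (hf i).diff, ?_⟩
  rw [D, fderiv_fun_sum fun i _ => (hf i).diff]
  simp only [_root_.sum_apply]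
  exact Finset.sum_congr rfl fun i _ => (hf i).eq

lemma HasD.coord (i : Fin 2) : HasD w (fun _ y => y i) x y (w.2 i) := by
  have : HasFDerivAt (fun z : E2 × E2 => z.2 i)
      ((EuclideanSpace.proj (𝕜 := ℝ) i).comp (ContinuousLinearMap.snd ℝ E2 E2)) (x, y) :=
    ((EuclideanSpace.proj (𝕜 := ℝ) i).comp (ContinuousLinearMap.snd ℝ E2 E2)).hasFDerivAt
  exact ⟨this.differentiableAt, by rw [D, this.fderiv]; simp⟩

lemma HasD.dx_eq {i : Fin 2} (hf : HasD (e i, 0) f x y a) : dx i f x y = a := by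
  have h2 : HasFDerivAt (fun x' : E2 => (x', y)) (ContinuousLinearMap.inl ℝ E2 E2) x :=
    hasFDerivAt_prodMk_left x y
  have := (HasFDerivAt.comp x (g := fun z : E2 × E2 => f z.1 z.2) hf.diff.hasFDerivAt h2).fderiv
  rw [← hf.eq]
  unfold dx D
  rw [show (fun x' => f x' y) = (fun z : E2 × E2 => f z.1 z.2) ∘ (fun x' : E2 => (x', y)) from rfl,
    this]
  simp

lemma HasD.dy_eq {i : Fin 2} (hf : HasD (0, e i) f x y a) : dy i f x y = a := by
  have h2 : HasFDerivAt (fun y' : E2 => (x, y')) (ContinuousLinearMap.inr ℝ E2 E2) y :=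
    hasFDerivAt_prodMk_right x y
  have := (HasFDerivAt.comp y (g := fun z : E2 × E2 => f z.1 z.2) hf.diff.hasFDerivAt h2).fderiv
  rw [← hf.eq]
  unfold dy D
  rw [show (fun y' => f x y') = (fun z : E2 × E2 => f z.1 z.2) ∘ (fun y' : E2 => (x, y')) from rfl,
    this]
  simp

end HasD

lemma dx_eq_D (hΩ : IsOpen Ω) (hf : Sm Ω f) (h : (x, y) ∈ Ω) (i : Fin 2) :
    dx i f x y = D (e i, 0) f x y := (hf.hasD hΩ h _).dx_eq

lemma dy_eq_D (hΩ : IsOpen Ω) (hf : Sm Ω f) (h : (x, y) ∈ Ω) (i : Fin 2) :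
    dy i f x y = D (0, e i) f x y := (hf.hasD hΩ h _).dy_eq

lemma Sm.hasDx (hΩ : IsOpen Ω) (hf : Sm Ω f) (h : (x, y) ∈ Ω) (i : Fin 2) :
    HasD (e i, 0) f x y (FinslerSurface.dx i f x y) := hf.hasD_of hΩ h (dx_eq_D hΩ hf h i).symm

lemma Sm.hasDy (hΩ : IsOpen Ω) (hf : Sm Ω f) (h : (x, y) ∈ Ω) (i : Fin 2) :
    HasD (0, e i) f x y (FinslerSurface.dy i f x y) := hf.hasD_of hΩ h (dy_eq_D hΩ hf h i).symm

lemma Sm.dx (hΩ : IsOpen Ω) (hf : Sm Ω f) (i : Fin 2) : Sm Ω (dx i f) :=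
  (hf.D hΩ (e i, 0)).congr fun _ _ h => dx_eq_D hΩ hf h i

lemma Sm.dy (hΩ : IsOpen Ω) (hf : Sm Ω f) (i : Fin 2) : Sm Ω (dy i f) :=
  (hf.D hΩ (0, e i)).congr fun _ _ h => dy_eq_D hΩ hf h i

lemma sum_e (v : E2) : v = ∑ i, v i • e i := by
  ext j; fin_cases j <;> simp

/-- The derivative along `(ξ, η)` in terms of partial derivatives. -/
lemma D_eq_sum (hΩ : IsOpen Ω) (hf : Sm Ω f) (h : (x, y) ∈ Ω) (w : E2 × E2) :
    D w f x y = ∑ i, w.1 i * FinslerSurface.dx i f x y + ∑ i, w.2 i * FinslerSurface.dy i f x y := by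
  have hw : w = ∑ i, w.1 i • ((e i, 0) : E2 × E2) + ∑ i, w.2 i • ((0, e i) : E2 × E2) := by
    refine Prod.ext ?_ ?_
    · simpa using sum_e w.1
    · simpa using sum_e w.2
  simp only [dx_eq_D hΩ hf h, dy_eq_D hΩ hf h]
  conv_lhs => rw [hw]
  simp only [D, map_add, map_sum, map_smul, smul_eq_mul]

lemma D_congr (hΩ : IsOpen Ω) (hfg : ∀ x y, (x, y) ∈ Ω → f x y = g x y) (h : (x, y) ∈ Ω)
    (w : E2 × E2) : D w f x y = D w g x y := by
  unfold D
  rw [Filter.EventuallyEq.fderiv_eq]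
  filter_upwards [hΩ.mem_nhds h] with z hz using hfg z.1 z.2 hz

lemma dy_congr (hΩ : IsOpen Ω) (hfg : ∀ x y, (x, y) ∈ Ω → f x y = g x y) (h : (x, y) ∈ Ω)
    (i : Fin 2) : dy i f x y = dy i g x y := by
  unfold dy
  rw [Filter.EventuallyEq.fderiv_eq]
  have : Filter.Tendsto (fun y' : E2 => (x, y')) (nhds y) (nhds (x, y)) :=
    (Continuous.prodMk_right x).tendsto y
  filter_upwards [this (hΩ.mem_nhds h)] with y' hy using hfg x y' hy

lemma dx_congr (hΩ : IsOpen Ω) (hfg : ∀ x y, (x, y) ∈ Ω → f x y = g x y) (h : (x, y) ∈ Ω)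
    (i : Fin 2) : dx i f x y = dx i g x y := by
  unfold dx
  rw [Filter.EventuallyEq.fderiv_eq]
  have : Filter.Tendsto (fun x' : E2 => (x', y)) (nhds x) (nhds (x, y)) :=
    (Continuous.prodMk_left y).tendsto x
  filter_upwards [this (hΩ.mem_nhds h)] with x' hx using hfg x' y hx

lemma D_comm (hΩ : IsOpen Ω) (hf : Sm Ω f) (h : (x, y) ∈ Ω) (v w : E2 × E2) :
    D v (D w f) x y = D w (D v f) x y := by
  have hs := (hf.contDiffAt (hΩ.mem_nhds h)).isSymmSndFDerivAt (n := ∞)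
    (by rw [minSmoothness_of_isRCLikeNormedField]; exact WithTop.coe_le_coe.2 (le_top : (2 : ℕ∞) ≤ ⊤))
  have hd : DifferentiableAt ℝ (fderiv ℝ (fun z : E2 × E2 => f z.1 z.2)) (x, y) :=
    ((hf.contDiffAt (hΩ.mem_nhds h)).fderiv_right (m := ∞) (by simp)).differentiableAt (by simp)
  have key : ∀ a b : E2 × E2, D a (D b f) x y
      = fderiv ℝ (fderiv ℝ (fun z : E2 × E2 => f z.1 z.2)) (x, y) a b := by
    intro a b
    change fderiv ℝ (fun z : E2 × E2 => fderiv ℝ (fun z : E2 × E2 => f z.1 z.2) (z.1, z.2) b)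
      (x, y) a = _
    rw [fderiv_clm_apply (c := fun z : E2 × E2 => fderiv ℝ (fun z : E2 × E2 => f z.1 z.2) (z.1, z.2))
      hd (differentiableAt_const b)]
    simp
  rw [key, key]
  exact hs.eq v w

lemma dy_comm (hΩ : IsOpen Ω) (hf : Sm Ω f) (h : (x, y) ∈ Ω) (i j : Fin 2) :
    dy i (dy j f) x y = dy j (dy i f) x y := by
  rw [dy_congr hΩ (fun x y h => dy_eq_D hΩ hf h j) h, dy_eq_D hΩ (hf.D hΩ _) h,
    dy_congr hΩ (fun x y h => dy_eq_D hΩ hf h i) h, dy_eq_D hΩ (hf.D hΩ _) h, D_comm hΩ hf h]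

lemma dx_dy_comm (hΩ : IsOpen Ω) (hf : Sm Ω f) (h : (x, y) ∈ Ω) (i j : Fin 2) :
    dx i (dy j f) x y = dy j (dx i f) x y := by
  rw [dx_congr hΩ (fun x y h => dy_eq_D hΩ hf h j) h, dx_eq_D hΩ (hf.D hΩ _) h,
    dy_congr hΩ (fun x y h => dx_eq_D hΩ hf h i) h, dy_eq_D hΩ (hf.D hΩ _) h, D_comm hΩ hf h]

end Calculus

/-! ### Derivations along vector fields that preserve the fibre-linear structure -/

/-- The derivative along the vector field `ξⁱ ∂ᵢ + Nʲₗ yˡ ∂̇ⱼ`. -/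
def lift (ξ : E2) (N : Fin 2 → Fin 2 → E2 → E2 → ℝ) (f : E2 → E2 → ℝ) (x y : E2) : ℝ :=
  D (ξ, WithLp.toLp 2 fun j => ∑ l, N j l x y * y l) f x y

section Lift

variable {Ω : Set (E2 × E2)} {f : E2 → E2 → ℝ} {x y : E2} {ξ : E2}
  {N : Fin 2 → Fin 2 → E2 → E2 → ℝ}

/-- `f` is locally constant along the fibres: `∂̇ᵢ f = 0` on `Ω`. -/
def VConst (Ω : Set (E2 × E2)) (f : E2 → E2 → ℝ) : Prop :=
  ∀ x y, (x, y) ∈ Ω → ∀ i, dy i f x y = 0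

lemma lift_eq_sum (hΩ : IsOpen Ω) (hf : Sm Ω f) (h : (x, y) ∈ Ω) :
    lift ξ N f x y = ∑ i, ξ i * dx i f x y + ∑ j, (∑ l, N j l x y * y l) * dy j f x y := by
  rw [lift, D_eq_sum hΩ hf h]

lemma Sm.hasD_lift (hΩ : IsOpen Ω) (hf : Sm Ω f) (h : (x, y) ∈ Ω) :
    HasD (ξ, WithLp.toLp 2 fun j => ∑ l, N j l x y * y l) f x y (lift ξ N f x y) :=
  hf.hasD hΩ h _

lemma Sm.lift (hΩ : IsOpen Ω) (hf : Sm Ω f) (hN : ∀ j l, Sm Ω (N j l)) :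
    Sm Ω (lift ξ N f) :=
  ((Sm.sum fun i => (Sm.const (ξ i)).mul (hf.dx hΩ i)).add
    (Sm.sum fun j => (Sm.sum fun l => (hN j l).mul (sm_coord l)).mul (hf.dy hΩ j))).congr
    fun _ _ h => lift_eq_sum hΩ hf h

/-- Commutation of a fibre-linear derivation with the vertical derivatives. -/
lemma lift_dy (hΩ : IsOpen Ω) (hf : Sm Ω f) (hN : ∀ j l, Sm Ω (N j l))
    (hN0 : ∀ j l, VConst Ω (N j l)) (h : (x, y) ∈ Ω) (i : Fin 2) :
    lift ξ N (dy i f) x y = dy i (lift ξ N f) x y - ∑ j, N j i x y * dy j f x y := by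
  have key : HasD (0, e i)
      (fun x y => ∑ i, ξ i * dx i f x y + ∑ j, (∑ l, N j l x y * y l) * dy j f x y) x y _ :=
    (HasD.sum fun a => (HasD.const (ξ a)).mul ((hf.dx hΩ a).hasDy hΩ h i)).add
      (HasD.sum fun j => (HasD.sum fun l => ((hN j l).hasDy hΩ h i).mul (HasD.coord l)).mul
        ((hf.dy hΩ j).hasDy hΩ h i))
  rw [dy_congr hΩ (fun x y h => lift_eq_sum hΩ hf h) h, key.dy_eq, lift_eq_sum hΩ (hf.dy hΩ i) h]
  simp only [hN0 _ _ x y h, dx_dy_comm hΩ hf h, Fin.sum_univ_two, dy_comm hΩ hf h i]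
  fin_cases i <;> simp <;> ring

end Lift

/-! ### Invariance of the main scalar -/

section Scalars

variable {Ω : Set (E2 × E2)} {K f c : E2 → E2 → ℝ} {x y : E2} {ξ : E2}
  {N : Fin 2 → Fin 2 → E2 → E2 → ℝ}

lemma metric_apply (K : E2 → E2 → ℝ) (x y : E2) (i j : Fin 2) :
    metric K x y i j = (1 / 2) * dy i (dy j fun x y => K x y ^ 2) x y := rfl

/-- `1 / √|det g|`. -/
def invDensity (K : E2 → E2 → ℝ) (x y : E2) : ℝ := (Real.sqrt |(metric K x y).det|)⁻¹

lemma eps_mul_det (K : E2 → E2 → ℝ) (x y : E2) :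
    eps K x y * (metric K x y).det = |(metric K x y).det| := by
  rcases lt_trichotomy (metric K x y).det 0 with h | h | h
  · simp [eps, Real.sign_of_neg h, abs_of_neg h]
  · simp [h]
  · simp [eps, Real.sign_of_pos h, abs_of_pos h]

lemma eps_sq (h : (metric K x y).det ≠ 0) : eps K x y * eps K x y = 1 := by
  rcases Real.sign_apply_eq_of_ne_zero _ h with h | h <;> simp [eps, h]

lemma vDer2_eq (h : (metric K x y).det ≠ 0) :
    vDer2 K f x y = K x y * (dy 0 K x y * dy 1 f x y - dy 1 K x y * dy 0 f x y)
      * invDensity K x y := by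
  have := eps_sq h
  simp only [vDer2, mUp, eps_mul_det, ellLow, invDensity, Fin.sum_univ_two, div_eq_mul_inv,
    Matrix.cons_val_zero, Matrix.cons_val_one]
  linear_combination (K x y * (dy 0 K x y * dy 1 f x y - dy 1 K x y * dy 0 f x y)
      * (√|(metric K x y).det|)⁻¹) * this

lemma hDer2_eq {F : E2 → E2 → ℝ} (h : (metric F x y).det ≠ 0) :
    hDer2 F f x y = (dy 0 F x y * delta F 1 f x y - dy 1 F x y * delta F 0 f x y)
      * invDensity F x y := by
  have := eps_sq h
  simp only [hDer2, mUp, eps_mul_det, ellLow, invDensity, Fin.sum_univ_two, div_eq_mul_inv,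
    Matrix.cons_val_zero, Matrix.cons_val_one]
  linear_combination ((dy 0 F x y * delta F 1 f x y - dy 1 F x y * delta F 0 f x y)
      * (√|(metric F x y).det|)⁻¹) * this

/-- The vector `(-∂̇₂K, ∂̇₁K)`, proportional to `mⁱ`. -/
def conormal (K : E2 → E2 → ℝ) (i : Fin 2) (x y : E2) : ℝ := ![-dy 1 K x y, dy 0 K x y] i

lemma mainScalar_eq (h : (metric K x y).det ≠ 0) :
    mainScalar K x y = K x y * (∑ i, ∑ j, ∑ k, cartan K i j k x y *
      (conormal K i x y * conormal K j x y * conormal K k x y)) *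
      (invDensity K x y * invDensity K x y * invDensity K x y) := by
  have := eps_sq h
  have e : ∀ i, mUp K i x y = eps K x y * invDensity K x y * conormal K i x y := by
    intro i
    rw [mUp, eps_mul_det, invDensity, conormal, div_eq_mul_inv]; rfl
  simp only [mainScalar, e]
  have e4 : eps K x y * eps K x y ^ 3 = 1 := by
    linear_combination (eps K x y ^ 2 + 1) * this
  simp only [Fin.sum_univ_two]
  generalize eps K x y = s at *
  generalize invDensity K x y = r at *
  generalize conormal K 0 x y = a at *
  generalize conormal K 1 x y = b at *
  generalize K x y = k at *
  linear_combination (k * (cartan K 0 0 0 x y * (a * a * a) + cartan K 0 0 1 x y * (a * a * b)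
    + (cartan K 0 1 0 x y * (a * b * a) + cartan K 0 1 1 x y * (a * b * b))
    + (cartan K 1 0 0 x y * (b * a * a) + cartan K 1 0 1 x y * (b * a * b)
    + (cartan K 1 1 0 x y * (b * b * a) + cartan K 1 1 1 x y * (b * b * b)))) * (r * r * r)) * e4

lemma Sm.metric (hΩ : IsOpen Ω) (hK : Sm Ω K) (i j : Fin 2) : Sm Ω (fun x y => metric K x y i j) :=
  (Sm.const (1 / 2)).mul (((hK.pow 2).dy hΩ j).dy hΩ i)

lemma Sm.cartan (hΩ : IsOpen Ω) (hK : Sm Ω K) (i j k : Fin 2) : Sm Ω (cartan K i j k) :=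
  (Sm.const (1 / 2)).mul ((hK.metric hΩ i j).dy hΩ k)

lemma Sm.det (hΩ : IsOpen Ω) (hK : Sm Ω K) : Sm Ω (fun x y => (FinslerSurface.metric K x y).det) := by
  simp only [Matrix.det_fin_two]
  exact ((hK.metric hΩ 0 0).mul (hK.metric hΩ 1 1)).sub ((hK.metric hΩ 0 1).mul (hK.metric hΩ 1 0))

lemma Sm.inv {f : E2 → E2 → ℝ} (hf : Sm Ω f) (h0 : ∀ x y, (x, y) ∈ Ω → f x y ≠ 0) :
    Sm Ω (fun x y => (f x y)⁻¹) := ContDiffOn.inv hf fun z hz => h0 z.1 z.2 hz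

lemma Sm.invDensity (hΩ : IsOpen Ω) (hK : Sm Ω K)
    (hdet : ∀ x y, (x, y) ∈ Ω → (FinslerSurface.metric K x y).det ≠ 0) : Sm Ω (invDensity K) :=
  (((hK.det hΩ).abs hdet).sqrt fun x y h => abs_ne_zero.2 (hdet x y h)).inv
    fun x y h => (Real.sqrt_ne_zero (abs_nonneg _)).2 (abs_ne_zero.2 (hdet x y h))

lemma Sm.conormal (hΩ : IsOpen Ω) (hK : Sm Ω K) (i : Fin 2) : Sm Ω (conormal K i) := by
  fin_cases i
  · exact (hK.dy hΩ 1).neg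
  · exact hK.dy hΩ 0

lemma Sm.mainScalar (hΩ : IsOpen Ω) (hK : Sm Ω K)
    (hdet : ∀ x y, (x, y) ∈ Ω → (FinslerSurface.metric K x y).det ≠ 0) : Sm Ω (mainScalar K) :=
  ((hK.mul (Sm.sum fun i => Sm.sum fun j => Sm.sum fun k => (hK.cartan hΩ i j k).mul
    (((hK.conormal hΩ i).mul (hK.conormal hΩ j)).mul (hK.conormal hΩ k)))).mul
    (((hK.invDensity hΩ hdet).mul (hK.invDensity hΩ hdet)).mul (hK.invDensity hΩ hdet))).congr
    fun x y h => mainScalar_eq (hdet x y h)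

lemma Sm.vDer2 (hΩ : IsOpen Ω) (hK : Sm Ω K) (hf : Sm Ω f)
    (hdet : ∀ x y, (x, y) ∈ Ω → (FinslerSurface.metric K x y).det ≠ 0) : Sm Ω (vDer2 K f) :=
  ((hK.mul (((hK.dy hΩ 0).mul (hf.dy hΩ 1)).sub ((hK.dy hΩ 1).mul (hf.dy hΩ 0)))).mul
    (hK.invDensity hΩ hdet)).congr fun x y h => vDer2_eq (hdet x y h)

/-- `K` has weight `c` under the fibre-linear derivation with coefficients `ξ`, `N`: the
derivation multiplies `K` by `c`, and `c` and the coefficients do not vary along the fibres. -/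
structure HasWeight (Ω : Set (E2 × E2)) (ξ : E2) (N : Fin 2 → Fin 2 → E2 → E2 → ℝ)
    (K c : E2 → E2 → ℝ) : Prop where
  isOpen : IsOpen Ω
  smooth : Sm Ω K
  smooth_coeff : ∀ j l, Sm Ω (N j l)
  coeff : ∀ j l, VConst Ω (N j l)
  smooth_weight : Sm Ω c
  weight : VConst Ω c
  det_ne : ∀ x y, (x, y) ∈ Ω → (metric K x y).det ≠ 0
  eq : ∀ x y, (x, y) ∈ Ω → lift ξ N K x y = c x y * K x y

namespace HasWeight

variable (W : HasWeight Ω ξ N K c)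
include W

lemma lift_dy (h : (x, y) ∈ Ω) (i : Fin 2) :
    lift ξ N (dy i K) x y = c x y * dy i K x y - ∑ j, N j i x y * dy j K x y := by
  rw [FinslerSurface.lift_dy W.isOpen W.smooth W.smooth_coeff W.coeff h, dy_congr W.isOpen W.eq h,
    ((W.smooth_weight.hasDy W.isOpen h i).mul (W.smooth.hasDy W.isOpen h i)).dy_eq,
    W.weight x y h]
  ring

lemma lift_sq (h : (x, y) ∈ Ω) :
    lift ξ N (fun x y => K x y ^ 2) x y = 2 * c x y * K x y ^ 2 := by
  rw [lift, (W.smooth.hasD_lift W.isOpen h).pow_two.eq, W.eq x y h]; ring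

lemma lift_dy_sq (h : (x, y) ∈ Ω) (i : Fin 2) :
    lift ξ N (dy i fun x y => K x y ^ 2) x y = 2 * c x y * dy i (fun x y => K x y ^ 2) x y
      - ∑ j, N j i x y * dy j (fun x y => K x y ^ 2) x y := by
  rw [FinslerSurface.lift_dy W.isOpen (W.smooth.pow 2) W.smooth_coeff W.coeff h,
    dy_congr W.isOpen (fun x y => W.lift_sq) h,
    (((HasD.const 2).mul (W.smooth_weight.hasDy W.isOpen h i)).mul
      ((W.smooth.pow 2).hasDy W.isOpen h i)).dy_eq, W.weight x y h]
  ring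

lemma lift_metric (h : (x, y) ∈ Ω) (i j : Fin 2) :
    lift ξ N (fun x y => metric K x y i j) x y = 2 * c x y * metric K x y i j
      - ∑ l, N l i x y * metric K x y l j - ∑ l, N l j x y * metric K x y i l := by
  have hs : ∀ j, Sm Ω (dy j fun x y => K x y ^ 2) := fun j => (W.smooth.pow 2).dy W.isOpen j
  have h1 : lift ξ N (dy i (dy j fun x y => K x y ^ 2)) x y =
      2 * c x y * dy i (dy j fun x y => K x y ^ 2) x y
      - ∑ l, N l j x y * dy i (dy l fun x y => K x y ^ 2) x y
      - ∑ l, N l i x y * dy l (dy j fun x y => K x y ^ 2) x y := by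
    rw [FinslerSurface.lift_dy W.isOpen (hs j) W.smooth_coeff W.coeff h,
      dy_congr W.isOpen (fun x y h => W.lift_dy_sq h j) h,
      ((((HasD.const 2).mul (W.smooth_weight.hasDy W.isOpen h i)).mul ((hs j).hasDy W.isOpen h i)).sub
        (HasD.sum fun l => ((W.smooth_coeff l j).hasDy W.isOpen h i).mul
          ((hs l).hasDy W.isOpen h i))).dy_eq]
    simp only [W.weight x y h, W.coeff _ _ x y h, Fin.sum_univ_two]
    ring
  have h2 : lift ξ N (fun x y => metric K x y i j) x y =
      1 / 2 * lift ξ N (dy i (dy j fun x y => K x y ^ 2)) x y := by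
    have := ((HasD.const (1 / 2)).mul (((hs j).dy W.isOpen i).hasD_lift (ξ := ξ) (N := N)
      W.isOpen h)).eq
    simp only [zero_mul, zero_add] at this
    exact this
  rw [h2, h1]
  simp only [metric_apply, Fin.sum_univ_two]
  ring

lemma lift_cartan (h : (x, y) ∈ Ω) (i j k : Fin 2) :
    lift ξ N (cartan K i j k) x y = 2 * c x y * cartan K i j k x y
      - ∑ l, N l i x y * cartan K l j k x y - ∑ l, N l j x y * cartan K i l k x y
      - ∑ l, N l k x y * cartan K i j l x y := by
  have hs : ∀ i j, Sm Ω (fun x y => metric K x y i j) := W.smooth.metric W.isOpen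
  have h1 : lift ξ N (dy k fun x y => metric K x y i j) x y =
      2 * c x y * dy k (fun x y => metric K x y i j) x y
      - ∑ l, N l i x y * dy k (fun x y => metric K x y l j) x y
      - ∑ l, N l j x y * dy k (fun x y => metric K x y i l) x y
      - ∑ l, N l k x y * dy l (fun x y => metric K x y i j) x y := by
    rw [FinslerSurface.lift_dy W.isOpen (hs i j) W.smooth_coeff W.coeff h,
      dy_congr W.isOpen (fun x y h => W.lift_metric h i j) h,
      (((((HasD.const 2).mul (W.smooth_weight.hasDy W.isOpen h k)).mul
        ((hs i j).hasDy W.isOpen h k)).sub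
        (HasD.sum fun l => ((W.smooth_coeff l i).hasDy W.isOpen h k).mul
          ((hs l j).hasDy W.isOpen h k))).sub
        (HasD.sum fun l => ((W.smooth_coeff l j).hasDy W.isOpen h k).mul
          ((hs i l).hasDy W.isOpen h k))).dy_eq]
    simp only [W.weight x y h, W.coeff _ _ x y h, Fin.sum_univ_two]
    ring
  have h2 : lift ξ N (cartan K i j k) x y =
      1 / 2 * lift ξ N (dy k fun x y => metric K x y i j) x y := by
    have := ((HasD.const (1 / 2)).mul (((hs i j).dy W.isOpen k).hasD_lift (ξ := ξ) (N := N)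
      W.isOpen h)).eq
    simp only [zero_mul, zero_add] at this
    exact this
  rw [h2, h1]
  simp only [cartan, Fin.sum_univ_two]
  ring

lemma lift_det (h : (x, y) ∈ Ω) :
    lift ξ N (fun x y => (metric K x y).det) x y =
      (4 * c x y - 2 * (N 0 0 x y + N 1 1 x y)) * (metric K x y).det := by
  have m := fun i j => (W.smooth.metric W.isOpen i j).hasD_lift (ξ := ξ) (N := N) W.isOpen h
  have := (((m 0 0).mul (m 1 1)).sub ((m 0 1).mul (m 1 0))).eq
  simp only [Matrix.det_fin_two]
  rw [lift, this]
  simp only [W.lift_metric h, Fin.sum_univ_two]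
  ring

lemma lift_invDensity (h : (x, y) ∈ Ω) :
    lift ξ N (invDensity K) x y = -(2 * c x y - (N 0 0 x y + N 1 1 x y)) * invDensity K x y := by
  have hd := W.det_ne x y h
  have hs : √|(metric K x y).det| ≠ 0 := (Real.sqrt_ne_zero (abs_nonneg _)).2 (abs_ne_zero.2 hd)
  have h1 : HasDerivAt (fun t : ℝ => √|t|) _ (metric K x y).det :=
    (hasDerivAt_abs hd).sqrt (abs_ne_zero.2 hd)
  have h2 := ((((W.smooth.det W.isOpen).hasD_lift (ξ := ξ) (N := N) W.isOpen h).comp h1).inv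
    (by exact hs)).eq
  refine Eq.trans h2 ?_
  rw [W.lift_det h, invDensity]
  have h3 : (SignType.sign (metric K x y).det : ℝ) * (metric K x y).det
      = √|(metric K x y).det| * √|(metric K x y).det| := by
    rw [Real.mul_self_sqrt (abs_nonneg _), sign_mul_self]
  generalize (SignType.sign (metric K x y).det : ℝ) = s at *
  field_simp
  linear_combination (-(4 * c x y - 2 * (N 0 0 x y + N 1 1 x y))) * h3

lemma lift_conormal (h : (x, y) ∈ Ω) (i : Fin 2) :
    lift ξ N (conormal K i) x y = (c x y - (N 0 0 x y + N 1 1 x y)) * conormal K i x y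
      + ∑ j, N i j x y * conormal K j x y := by
  fin_cases i
  · have := ((W.smooth.dy W.isOpen 1).hasD_lift (ξ := ξ) (N := N) W.isOpen h).neg.eq
    refine Eq.trans this ?_
    rw [W.lift_dy h]
    simp [conormal]; ring
  · refine Eq.trans (W.lift_dy h 0) ?_
    simp [conormal]; ring

/-- The main scalar has weight zero: it is invariant under any derivation that scales the metric
function by a factor constant along the fibres. -/
lemma lift_mainScalar (h : (x, y) ∈ Ω) : lift ξ N (mainScalar K) x y = 0 := by
  have hK := W.smooth.hasD_lift (ξ := ξ) (N := N) W.isOpen h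
  have hr := (W.smooth.invDensity W.isOpen W.det_ne).hasD_lift (ξ := ξ) (N := N) W.isOpen h
  have hn := fun i => (W.smooth.conormal W.isOpen i).hasD_lift (ξ := ξ) (N := N) W.isOpen h
  have hC := fun i j k => (W.smooth.cartan W.isOpen i j k).hasD_lift (ξ := ξ) (N := N) W.isOpen h
  have := ((hK.mul (HasD.sum fun i => HasD.sum fun j => HasD.sum fun k =>
    (hC i j k).mul (((hn i).mul (hn j)).mul (hn k)))).mul ((hr.mul hr).mul hr)).eq
  rw [lift, D_congr W.isOpen (fun x y h => mainScalar_eq (W.det_ne x y h)) h, this]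
  simp only [W.eq x y h, W.lift_invDensity h, W.lift_conormal h, W.lift_cartan h, Fin.sum_univ_two]
  ring

/-- The vertical scalar derivative commutes with any such derivation. -/
lemma lift_vDer2 (hf : Sm Ω f) (h : (x, y) ∈ Ω) :
    lift ξ N (vDer2 K f) x y = vDer2 K (lift ξ N f) x y := by
  have hK := W.smooth.hasD_lift (ξ := ξ) (N := N) W.isOpen h
  have hr := (W.smooth.invDensity W.isOpen W.det_ne).hasD_lift (ξ := ξ) (N := N) W.isOpen h
  have hk := fun i => (W.smooth.dy W.isOpen i).hasD_lift (ξ := ξ) (N := N) W.isOpen h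
  have hg := fun i => (hf.dy W.isOpen i).hasD_lift (ξ := ξ) (N := N) W.isOpen h
  have := ((hK.mul (((hk 0).mul (hg 1)).sub ((hk 1).mul (hg 0)))).mul hr).eq
  rw [lift, D_congr W.isOpen (fun x y h => vDer2_eq (W.det_ne x y h)) h, this,
    vDer2_eq (W.det_ne x y h)]
  simp only [W.eq x y h, W.lift_invDensity h, W.lift_dy h,
    FinslerSurface.lift_dy W.isOpen hf W.smooth_coeff W.coeff h, Fin.sum_univ_two]
  ring

end HasWeight

end Scalars

/-! ### Homogeneous functions and their metric tensor -/

section Homogeneous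

variable {Ω : Set (E2 × E2)} {K f : E2 → E2 → ℝ} {x y : E2}

/-- Euler's relation. -/
lemma euler (hΩ : IsOpen Ω) (hf : Sm Ω f) (r : ℕ) (h : (x, y) ∈ Ω)
    (hom : ∀ t : ℝ, 0 < t → f x (t • y) = t ^ r * f x y) :
    ∑ i, y i * dy i f x y = r * f x y := by
  have h1 : HasDerivAt (fun t : ℝ => ((x, t • y) : E2 × E2)) (0, (1 : ℝ) • y) 1 :=
    (hasDerivAt_const _ _).prodMk ((hasDerivAt_id (1 : ℝ)).smul_const y)
  have hd : HasFDerivAt (fun z : E2 × E2 => f z.1 z.2)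
      (fderiv ℝ (fun z : E2 × E2 => f z.1 z.2) (x, y)) (x, (1 : ℝ) • y) := by
    rw [one_smul]; exact (hf.differentiableAt hΩ h).hasFDerivAt
  have h2 := hd.comp_hasDerivAt (1 : ℝ) h1
  have h3 : HasDerivAt (fun t : ℝ => t ^ r * f x y) (r * f x y) 1 := by
    simpa using (hasDerivAt_pow r (1 : ℝ)).mul_const (f x y)
  have h4 : (fun t : ℝ => t ^ r * f x y) =ᶠ[nhds 1]
      (fun z : E2 × E2 => f z.1 z.2) ∘ fun t : ℝ => ((x, t • y) : E2 × E2) := by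
    filter_upwards [lt_mem_nhds (zero_lt_one (α := ℝ))] with t ht
    exact (hom t ht).symm
  have h5 := (h2.congr_of_eventuallyEq h4).unique h3
  rw [← h5, one_smul]
  have := D_eq_sum hΩ hf h (0, y)
  simp only [D] at this
  rw [this]
  simp

lemma metric_eq (hΩ : IsOpen Ω) (hK : Sm Ω K) (h : (x, y) ∈ Ω) (i j : Fin 2) :
    metric K x y i j = dy i K x y * dy j K x y + K x y * dy i (dy j K) x y := by
  rw [metric_apply, dy_congr hΩ (fun x y h => (hK.hasDy hΩ h j).pow_two.dy_eq) h,
    (((HasD.const 2).mul (hK.hasDy hΩ h i)).mul ((hK.dy hΩ j).hasDy hΩ h i)).dy_eq]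
  ring

lemma metric_symm (hΩ : IsOpen Ω) (hK : Sm Ω K) (h : (x, y) ∈ Ω) (i j : Fin 2) :
    metric K x y i j = metric K x y j i := by
  rw [metric_apply, metric_apply, dy_comm hΩ (hK.pow 2) h]

/-- The derivative of Euler's relation. -/
lemma euler_dy (hΩ : IsOpen Ω) (hf : Sm Ω f) (r : ℝ)
    (he : ∀ x y, (x, y) ∈ Ω → ∑ i, y i * dy i f x y = r * f x y) (h : (x, y) ∈ Ω) (j : Fin 2) :
    ∑ i, y i * dy i (dy j f) x y = (r - 1) * dy j f x y := by
  have h1 := (HasD.sum fun i => (HasD.coord (w := (0, e j)) i).mul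
    ((hf.dy hΩ i).hasDy hΩ h j)).dy_eq
  rw [dy_congr hΩ he h, ((HasD.const r).mul (hf.hasDy hΩ h j)).dy_eq] at h1
  simp only [Fin.sum_univ_two, dy_comm hΩ hf h j] at h1 ⊢
  fin_cases j <;> simp at h1 ⊢ <;> linarith

lemma metric_mulVec (hΩ : IsOpen Ω) (hK : Sm Ω K)
    (he : ∀ x y, (x, y) ∈ Ω → ∑ i, y i * dy i K x y = K x y) (h : (x, y) ∈ Ω) (j : Fin 2) :
    ∑ i, metric K x y i j * y i = K x y * dy j K x y := by
  have h1 := euler_dy hΩ hK 1 (by simpa using he) h j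
  have h2 := he x y h
  simp only [metric_eq hΩ hK h, Fin.sum_univ_two] at h1 h2 ⊢
  linear_combination K x y * h1 + dy j K x y * h2

lemma ne_zero_of_det (hΩ : IsOpen Ω) (hK : Sm Ω K) (h : (x, y) ∈ Ω)
    (hdet : (metric K x y).det ≠ 0) : K x y ≠ 0 := by
  intro h0
  apply hdet
  rw [Matrix.det_fin_two]
  simp only [metric_eq hΩ hK h, h0]
  ring

/-- The determinant of the metric tensor, computed on the span of `y` and `(n₀, n₁)`. -/
lemma det_metric_mul_sq (hΩ : IsOpen Ω) (hK : Sm Ω K)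
    (he : ∀ x y, (x, y) ∈ Ω → ∑ i, y i * dy i K x y = K x y) (h : (x, y) ∈ Ω) (n₀ n₁ : ℝ) :
    (metric K x y).det * (y 0 * n₁ - y 1 * n₀) ^ 2 = K x y ^ 3 *
      (dy 0 (dy 0 K) x y * n₀ ^ 2 + 2 * dy 0 (dy 1 K) x y * n₀ * n₁
        + dy 1 (dy 1 K) x y * n₁ ^ 2) := by
  have m := metric_mulVec hΩ hK he h
  have m0 := m 0
  have m1 := m 1
  have h1 := he x y h
  have q := metric_eq hΩ hK h
  have q00 := q 0 0
  have q01 := q 0 1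
  have q11 := q 1 1
  have s := metric_symm hΩ hK h 1 0
  rw [Matrix.det_fin_two]
  simp only [Fin.sum_univ_two, s] at *
  generalize metric K x y 0 0 = a at *
  generalize metric K x y 0 1 = b at *
  generalize metric K x y 1 1 = c at *
  generalize dy 0 K x y = k0 at *
  generalize dy 1 K x y = k1 at *
  have e1 : (a * c - b * b) * (y 0 * n₁ - y 1 * n₀) ^ 2 =
      (y 0 * (a * y 0 + b * y 1) + y 1 * (b * y 0 + c * y 1))
        * (a * n₀ ^ 2 + 2 * b * n₀ * n₁ + c * n₁ ^ 2)
      - (n₀ * (a * y 0 + b * y 1) + n₁ * (b * y 0 + c * y 1)) ^ 2 := by ring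
  have e2 : y 0 * (K x y * k0) + y 1 * (K x y * k1) = K x y ^ 2 := by
    linear_combination K x y * h1
  rw [e1, m0, m1, e2, q00, q01, q11]
  ring

/-- The identity as a matrix of functions; with it `lift` is the Euler field. -/
def idCoeff (j l : Fin 2) : E2 → E2 → ℝ := fun _ _ => (1 : Matrix (Fin 2) (Fin 2) ℝ) j l

lemma vConst_const (a : ℝ) : VConst Ω (fun _ _ => a) := fun _ _ _ _ => (HasD.const a).dy_eq

lemma hasWeight_euler (hΩ : IsOpen Ω) (hK : Sm Ω K)
    (hdet : ∀ x y, (x, y) ∈ Ω → (metric K x y).det ≠ 0)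
    (he : ∀ x y, (x, y) ∈ Ω → ∑ i, y i * dy i K x y = K x y) :
    HasWeight Ω 0 idCoeff K (fun _ _ => 1) where
  isOpen := hΩ
  smooth := hK
  smooth_coeff _ _ := Sm.const _
  coeff _ _ := vConst_const _
  smooth_weight := Sm.const _
  weight := vConst_const _
  det_ne := hdet
  eq x y h := by
    rw [lift_eq_sum hΩ hK h, one_mul, ← he x y h]
    simp [idCoeff]

lemma euler_mainScalar (hΩ : IsOpen Ω) (hK : Sm Ω K)
    (hdet : ∀ x y, (x, y) ∈ Ω → (metric K x y).det ≠ 0)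
    (he : ∀ x y, (x, y) ∈ Ω → ∑ i, y i * dy i K x y = K x y) (h : (x, y) ∈ Ω) :
    ∑ i, y i * dy i (mainScalar K) x y = 0 := by
  have := (hasWeight_euler hΩ hK hdet he).lift_mainScalar h
  rw [lift_eq_sum hΩ (hK.mainScalar hΩ hdet) h] at this
  simpa [idCoeff] using this

end Homogeneous

/-! ### The connection of a conic pseudo-Riemannian metric -/

section VConst

variable {Ω : Set (E2 × E2)} {f g : E2 → E2 → ℝ}

lemma VConst.add (hΩ : IsOpen Ω) (hf : VConst Ω f) (hg : VConst Ω g) (sf : Sm Ω f) (sg : Sm Ω g) :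
    VConst Ω (fun x y => f x y + g x y) := fun x y h i => by
  rw [((sf.hasDy hΩ h i).add (sg.hasDy hΩ h i)).dy_eq, hf x y h, hg x y h, add_zero]

lemma VConst.sub (hΩ : IsOpen Ω) (hf : VConst Ω f) (hg : VConst Ω g) (sf : Sm Ω f) (sg : Sm Ω g) :
    VConst Ω (fun x y => f x y - g x y) := fun x y h i => by
  rw [((sf.hasDy hΩ h i).sub (sg.hasDy hΩ h i)).dy_eq, hf x y h, hg x y h, sub_zero]

lemma VConst.neg (hΩ : IsOpen Ω) (hf : VConst Ω f) (sf : Sm Ω f) :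
    VConst Ω (fun x y => -f x y) := fun x y h i => by
  rw [(sf.hasDy hΩ h i).neg.dy_eq, hf x y h, neg_zero]

lemma VConst.mul (hΩ : IsOpen Ω) (hf : VConst Ω f) (hg : VConst Ω g) (sf : Sm Ω f) (sg : Sm Ω g) :
    VConst Ω (fun x y => f x y * g x y) := fun x y h i => by
  rw [((sf.hasDy hΩ h i).mul (sg.hasDy hΩ h i)).dy_eq, hf x y h, hg x y h, zero_mul, mul_zero,
    add_zero]

lemma VConst.inv (hΩ : IsOpen Ω) (hf : VConst Ω f) (sf : Sm Ω f)
    (h0 : ∀ x y, (x, y) ∈ Ω → f x y ≠ 0) : VConst Ω (fun x y => (f x y)⁻¹) := fun x y h i => by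
  rw [((sf.hasDy hΩ h i).inv (h0 x y h)).dy_eq, hf x y h]; ring

lemma VConst.sum (hΩ : IsOpen Ω) {ι : Type*} [Fintype ι] {f : ι → E2 → E2 → ℝ}
    (hf : ∀ i, VConst Ω (f i)) (sf : ∀ i, Sm Ω (f i)) : VConst Ω (fun x y => ∑ i, f i x y) :=
  fun x y h i => by
    rw [(HasD.sum fun a => (sf a).hasDy hΩ h i).dy_eq]
    exact Finset.sum_eq_zero fun a _ => hf a x y h i

lemma VConst.dx (hΩ : IsOpen Ω) (hf : VConst Ω f) (sf : Sm Ω f) (i : Fin 2) :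
    VConst Ω (dx i f) := fun x y h j => by
  rw [← dx_dy_comm hΩ sf h, dx_congr hΩ (fun x y h => hf x y h j) h]
  exact (HasD.const 0).dx_eq

end VConst

/-- A conic pseudo-Riemannian metric in coordinates. -/
structure CoordRiemannian (Ω : Set (E2 × E2)) (F : E2 → E2 → ℝ) : Prop where
  isOpen : IsOpen Ω
  smooth : Sm Ω F
  hom : ∀ x y, (x, y) ∈ Ω → ∀ t : ℝ, 0 < t → F x (t • y) = t ^ 1 * F x y
  det_ne : ∀ x y, (x, y) ∈ Ω → (metric F x y).det ≠ 0
  cartan : ∀ x y, (x, y) ∈ Ω → ∀ i j k, cartan F i j k x y = 0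

/-- The Christoffel symbols `Γⁱⱼₖ = ½ gⁱˡ (∂ⱼ gₗₖ + ∂ₖ gₗⱼ - ∂ₗ gⱼₖ)`. -/
def christoffel (F : E2 → E2 → ℝ) (i j k : Fin 2) (x y : E2) : ℝ :=
  ∑ l, (1 / 2) * ((metric F x y)⁻¹ i l * (dx j (fun x y => metric F x y l k) x y
    + dx k (fun x y => metric F x y l j) x y - dx l (fun x y => metric F x y j k) x y))

/-- The coefficients which make `lift` along `∂ₖ` the horizontal derivation `δₖ`. -/
def connCoeff (F : E2 → E2 → ℝ) (k j l : Fin 2) (x y : E2) : ℝ := -christoffel F j k l x y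

lemma metric_inv_apply (F : E2 → E2 → ℝ) (i j : Fin 2) (x y : E2) : (metric F x y)⁻¹ i j = ((metric F x y).det)⁻¹ *
    ![![metric F x y 1 1, -metric F x y 0 1], ![-metric F x y 1 0, metric F x y 0 0]] i j := by
  rw [Matrix.inv_def, Matrix.adjugate_fin_two, Ring.inverse_eq_inv', Matrix.smul_apply, smul_eq_mul]
  rfl

namespace CoordRiemannian

variable {Ω : Set (E2 × E2)} {F f : E2 → E2 → ℝ} {x y : E2} (R : CoordRiemannian Ω F)
include R

lemma euler (h : (x, y) ∈ Ω) : ∑ i, y i * dy i F x y = F x y := by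
  simpa using FinslerSurface.euler R.isOpen R.smooth 1 h (R.hom x y h)

lemma ne_zero (h : (x, y) ∈ Ω) : F x y ≠ 0 :=
  ne_zero_of_det R.isOpen R.smooth h (R.det_ne x y h)

lemma smooth_metric (i j : Fin 2) : Sm Ω (fun x y => metric F x y i j) :=
  R.smooth.metric R.isOpen i j

lemma vConst_metric (i j : Fin 2) : VConst Ω (fun x y => metric F x y i j) := fun x y h k => by
  have := R.cartan x y h i j k
  rw [FinslerSurface.cartan] at this
  linarith

lemma smooth_inv (i j : Fin 2) : Sm Ω (fun x y => (metric F x y)⁻¹ i j) := by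
  simp only [metric_inv_apply]
  have hd := (R.smooth.det R.isOpen).inv R.det_ne
  fin_cases i <;> fin_cases j
  · exact hd.mul (R.smooth_metric 1 1)
  · exact hd.mul (R.smooth_metric 0 1).neg
  · exact hd.mul (R.smooth_metric 1 0).neg
  · exact hd.mul (R.smooth_metric 0 0)

lemma vConst_inv (i j : Fin 2) : VConst Ω (fun x y => (metric F x y)⁻¹ i j) := by
  have s := R.smooth_metric
  have v := R.vConst_metric
  have hΩ := R.isOpen
  have hd : VConst Ω (fun x y => ((metric F x y).det)⁻¹) := by
    refine VConst.inv hΩ ?_ (R.smooth.det hΩ) R.det_ne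
    simp only [Matrix.det_fin_two]
    exact (((v 0 0).mul hΩ (v 1 1) (s _ _) (s _ _)).sub hΩ
      ((v 0 1).mul hΩ (v 1 0) (s _ _) (s _ _)) ((s _ _).mul (s _ _)) ((s _ _).mul (s _ _)))
  have sd := (R.smooth.det hΩ).inv R.det_ne
  simp only [metric_inv_apply]
  fin_cases i <;> fin_cases j
  · exact hd.mul hΩ (v 1 1) sd (s 1 1)
  · exact hd.mul hΩ ((v 0 1).neg hΩ (s 0 1)) sd (s 0 1).neg
  · exact hd.mul hΩ ((v 1 0).neg hΩ (s 1 0)) sd (s 1 0).neg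
  · exact hd.mul hΩ (v 0 0) sd (s 0 0)

lemma smooth_christoffel (i j k : Fin 2) : Sm Ω (christoffel F i j k) :=
  Sm.sum fun l => (Sm.const _).mul ((R.smooth_inv i l).mul ((((R.smooth_metric l k).dx R.isOpen j).add
    ((R.smooth_metric l j).dx R.isOpen k)).sub ((R.smooth_metric j k).dx R.isOpen l)))

lemma vConst_christoffel (i j k : Fin 2) : VConst Ω (christoffel F i j k) := by
  have hΩ := R.isOpen
  have s := fun i j k => (R.smooth_metric i j).dx hΩ k
  have v := fun i j k => (R.vConst_metric i j).dx hΩ (R.smooth_metric i j) k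
  have v1 := fun l => ((v l k j).add hΩ (v l j k) (s _ _ _) (s _ _ _)).sub hΩ (v j k l)
    ((s l k j).add (s l j k)) (s j k l)
  have s1 := fun l => ((s l k j).add (s l j k)).sub (s j k l)
  exact VConst.sum hΩ (fun l => (vConst_const _).mul hΩ
    ((R.vConst_inv i l).mul hΩ (v1 l) (R.smooth_inv i l) (s1 l)) (Sm.const _)
    ((R.smooth_inv i l).mul (s1 l)))
    fun l => (Sm.const _).mul ((R.smooth_inv i l).mul (s1 l))

lemma dx_metric_symm (h : (x, y) ∈ Ω) (i j k : Fin 2) :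
    dx k (fun x y => metric F x y i j) x y = dx k (fun x y => metric F x y j i) x y :=
  dx_congr R.isOpen (fun _ _ h => metric_symm R.isOpen R.smooth h i j) h k

lemma christoffel_symm (h : (x, y) ∈ Ω) (i j k : Fin 2) :
    christoffel F i j k x y = christoffel F i k j x y := by
  simp only [christoffel, R.dx_metric_symm h j k]
  exact Finset.sum_congr rfl fun l _ => by ring

lemma dy_sq_eq (h : (x, y) ∈ Ω) (l : Fin 2) :
    dy l (fun x y => F x y ^ 2) x y = ∑ j, 2 * (metric F x y l j * y j) := by
  have h1 := metric_mulVec R.isOpen R.smooth (fun _ _ => R.euler) h l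
  rw [(R.smooth.hasDy R.isOpen h l).pow_two.dy_eq, mul_assoc, ← h1, Finset.mul_sum]
  exact Finset.sum_congr rfl fun j _ => by rw [metric_symm R.isOpen R.smooth h l j]

lemma sq_eq (h : (x, y) ∈ Ω) : F x y ^ 2 = ∑ i, ∑ j, metric F x y i j * (y i * y j) := by
  have h1 := metric_mulVec R.isOpen R.smooth (fun _ _ => R.euler) h
  have h2 := R.euler h
  have a := h1 0
  have b := h1 1
  simp only [Fin.sum_univ_two] at a b h2 ⊢
  linear_combination -(y 0) * a - y 1 * b - F x y * h2

lemma dx_dy_sq (h : (x, y) ∈ Ω) (k l : Fin 2) : dx k (dy l fun x y => F x y ^ 2) x y =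
    ∑ j, 2 * (dx k (fun x y => metric F x y l j) x y * y j) := by
  rw [dx_congr R.isOpen (fun _ _ h => R.dy_sq_eq h l) h,
    (HasD.sum fun j => (HasD.const 2).mul
      (((R.smooth_metric l j).hasDx R.isOpen h k).mul (HasD.coord j))).dx_eq]
  simp

lemma dx_sq (h : (x, y) ∈ Ω) (k : Fin 2) : dx k (fun x y => F x y ^ 2) x y =
    ∑ i, ∑ j, dx k (fun x y => metric F x y i j) x y * (y i * y j) := by
  rw [dx_congr R.isOpen (fun _ _ h => R.sq_eq h) h,
    (HasD.sum fun i => HasD.sum fun j => ((R.smooth_metric i j).hasDx R.isOpen h k).mul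
      ((HasD.coord i).mul (HasD.coord j))).dx_eq]
  simp

lemma sprayCoeff_eq (h : (x, y) ∈ Ω) (i : Fin 2) : sprayCoeff F i x y =
    ∑ j, ∑ k, (1 / 2) * (christoffel F i j k x y * (y j * y k)) := by
  simp only [sprayCoeff, R.dx_dy_sq h, R.dx_sq h, christoffel, Fin.sum_univ_two,
    R.dx_metric_symm h 1 0]
  ring

lemma barthel_eq (h : (x, y) ∈ Ω) (j i : Fin 2) :
    barthel F j i x y = ∑ l, christoffel F j i l x y * y l := by
  rw [barthel, dy_congr R.isOpen (fun _ _ h => R.sprayCoeff_eq h j) h,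
    (HasD.sum fun a => HasD.sum fun b => (HasD.const (1 / 2)).mul
      (((R.smooth_christoffel j a b).hasDy R.isOpen h i).mul
        ((HasD.coord a).mul (HasD.coord b)))).dy_eq]
  simp only [R.vConst_christoffel _ _ _ x y h, Fin.sum_univ_two, R.christoffel_symm h j 1 0]
  fin_cases i <;> simp [R.christoffel_symm h j 1 0] <;> ring

lemma delta_eq (hf : Sm Ω f) (h : (x, y) ∈ Ω) (k : Fin 2) :
    delta F k f x y = lift (e k) (connCoeff F k) f x y := by
  rw [lift_eq_sum R.isOpen hf h, delta]
  simp only [R.barthel_eq h, connCoeff, Fin.sum_univ_two]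
  fin_cases k <;> simp <;> ring

lemma christoffel_lower (h : (x, y) ∈ Ω) (m k l : Fin 2) :
    ∑ j, metric F x y m j * christoffel F j k l x y =
      (1 / 2) * (dx k (fun x y => metric F x y m l) x y + dx l (fun x y => metric F x y m k) x y
        - dx m (fun x y => metric F x y k l) x y) := by
  have hu : IsUnit (metric F x y).det := isUnit_iff_ne_zero.2 (R.det_ne x y h)
  have h1 : ∀ a b, ∑ j, metric F x y a j * (metric F x y)⁻¹ j b
      = (1 : Matrix (Fin 2) (Fin 2) ℝ) a b := fun a b => by
    rw [← Matrix.mul_nonsing_inv _ hu, Matrix.mul_apply]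
  have a := h1 m 0
  have b := h1 m 1
  simp only [christoffel, Fin.sum_univ_two] at a b ⊢
  fin_cases m
  · simp [Matrix.one_apply] at a b ⊢
    linear_combination ((1 / 2) * (dx k (fun x y => metric F x y 0 l) x y
      + dx l (fun x y => metric F x y 0 k) x y - dx 0 (fun x y => metric F x y k l) x y)) * a
      + ((1 / 2) * (dx k (fun x y => metric F x y 1 l) x y
      + dx l (fun x y => metric F x y 1 k) x y - dx 1 (fun x y => metric F x y k l) x y)) * b
  · simp [Matrix.one_apply] at a b ⊢
    linear_combination ((1 / 2) * (dx k (fun x y => metric F x y 0 l) x y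
      + dx l (fun x y => metric F x y 0 k) x y - dx 0 (fun x y => metric F x y k l) x y)) * a
      + ((1 / 2) * (dx k (fun x y => metric F x y 1 l) x y
      + dx l (fun x y => metric F x y 1 k) x y - dx 1 (fun x y => metric F x y k l) x y)) * b

/-- The metric function is horizontally constant. -/
lemma delta_self (h : (x, y) ∈ Ω) (k : Fin 2) : lift (e k) (connCoeff F k) F x y = 0 := by
  have h1 := (R.smooth.hasD_lift (ξ := e k) (N := connCoeff F k) R.isOpen h).pow_two.eq
  change lift (e k) (connCoeff F k) (fun x y => F x y ^ 2) x y = _ at h1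
  rw [← R.delta_eq (R.smooth.pow 2) h, delta] at h1
  have h0 := R.ne_zero h
  have h2 : dx k (fun x y => F x y ^ 2) x y
      - ∑ j, barthel F j k x y * dy j (fun x y => F x y ^ 2) x y = 0 := by
    have a := fun m l => R.christoffel_lower h m k l
    have a00 := a 0 0
    have a01 := a 0 1
    have a10 := a 1 0
    have a11 := a 1 1
    have s := R.dx_metric_symm h 1 0
    have s' := metric_symm R.isOpen R.smooth h 1 0
    rw [R.dx_sq h]
    simp only [R.dy_sq_eq h, R.barthel_eq h, Fin.sum_univ_two, s, s'] at a00 a01 a10 a11 ⊢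
    fin_cases k <;> simp [s] at a00 a01 a10 a11 ⊢
    · linear_combination (-2 * y 0 * y 0) * a00 - 2 * y 0 * y 1 * a01 - 2 * y 0 * y 1 * a10
        - 2 * y 1 * y 1 * a11
    · linear_combination (-2 * y 0 * y 0) * a00 - 2 * y 0 * y 1 * a01 - 2 * y 0 * y 1 * a10
        - 2 * y 1 * y 1 * a11
  rw [h2] at h1
  rcases mul_eq_zero.1 h1.symm with h3 | h3
  · exact absurd h3 (by simpa using h0)
  · exact h3

lemma hasWeight (k : Fin 2) : HasWeight Ω (e k) (connCoeff F k) F (fun _ _ => 0) where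
  isOpen := R.isOpen
  smooth := R.smooth
  smooth_coeff _ _ := (R.smooth_christoffel _ _ _).neg
  coeff _ _ := (R.vConst_christoffel _ _ _).neg R.isOpen (R.smooth_christoffel _ _ _)
  smooth_weight := Sm.const _
  weight := vConst_const _
  det_ne := R.det_ne
  eq x y h := by rw [R.delta_self h, zero_mul]

end CoordRiemannian

/-! ### The anisotropic conformal change in coordinates -/

/-- The metric function `e^φ F` in coordinates. -/
def coordChange (φ F : E2 → E2 → ℝ) (x y : E2) : ℝ := Real.exp (φ x y) * F x y

/-- An anisotropic conformal change of a conic pseudo-Riemannian metric, in coordinates, with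
`φ_{;2}` horizontally constant. -/
structure CoordChange (Ω : Set (E2 × E2)) (F φ : E2 → E2 → ℝ) : Prop
    extends CoordRiemannian Ω F where
  smooth_factor : Sm Ω φ
  hom_factor : ∀ x y, (x, y) ∈ Ω → ∀ t : ℝ, 0 < t → φ x (t • y) = t ^ 0 * φ x y
  nondegenerate : ∀ x y, (x, y) ∈ Ω → F x y ^ 2 *
        (∑ i, ∑ j, (dy i (dy j φ) x y + dy i φ x y * dy j φ x y) * mUp F i x y * mUp F j x y)
      + eps F x y ≠ 0
  delta_vDer2 : ∀ x y, (x, y) ∈ Ω → ∀ i, delta F i (vDer2 F φ) x y = 0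

/-- The scalar whose vanishing is equivalent to that of the `T`-tensor of `e^φ F`: the vertical
scalar derivative, with respect to `e^φ F`, of its main scalar. -/
def tScalar (φ F : E2 → E2 → ℝ) : E2 → E2 → ℝ :=
  vDer2 (coordChange φ F) (mainScalar (coordChange φ F))

/-- `∂̇₁F̄ δ₂φ - ∂̇₂F̄ δ₁φ` for `F̄ = e^φ F`; it vanishes if and only if `φ_{;2} φ_{,1} = φ_{,2}`. -/
def defect (φ F : E2 → E2 → ℝ) (x y : E2) : ℝ :=
  dy 0 (coordChange φ F) x y * delta F 1 φ x y - dy 1 (coordChange φ F) x y * delta F 0 φ x y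

lemma invDensity_ne_zero {K : E2 → E2 → ℝ} {x y : E2} (h : (metric K x y).det ≠ 0) :
    invDensity K x y ≠ 0 :=
  inv_ne_zero ((Real.sqrt_ne_zero (abs_nonneg _)).2 (abs_ne_zero.2 h))

lemma defect_eq_zero {F φ : E2 → E2 → ℝ} {x y : E2}
    (h0 : ∀ k, delta F k φ x y = 0) : defect φ F x y = 0 := by
  simp [defect, h0]

lemma mUp_eq (F : E2 → E2 → ℝ) (i : Fin 2) (x y : E2) :
    mUp F i x y = eps F x y * invDensity F x y * conormal F i x y := by
  rw [mUp, eps_mul_det, invDensity, conormal, div_eq_mul_inv]; rfl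

lemma invDensity_sq_mul_det {K : E2 → E2 → ℝ} {x y : E2} (h : (metric K x y).det ≠ 0) :
    invDensity K x y * invDensity K x y * (metric K x y).det = eps K x y := by
  have h2 := eps_mul_det K x y
  have h3 : √|(metric K x y).det| * √|(metric K x y).det| = |(metric K x y).det| :=
    Real.mul_self_sqrt (abs_nonneg _)
  have h4 : √|(metric K x y).det| ≠ 0 := (Real.sqrt_ne_zero (abs_nonneg _)).2 (abs_ne_zero.2 h)
  rw [invDensity]
  field_simp
  rw [pow_two, h3, ← h2]
  linear_combination (-(metric K x y).det) * eps_sq h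

namespace CoordChange

variable {Ω : Set (E2 × E2)} {F φ : E2 → E2 → ℝ} {x y : E2} (C : CoordChange Ω F φ)
include C

lemma euler_factor (h : (x, y) ∈ Ω) : ∑ i, y i * dy i φ x y = 0 := by
  simpa using FinslerSurface.euler C.isOpen C.smooth_factor 0 h (C.hom_factor x y h)

lemma smooth_change : Sm Ω (coordChange φ F) := C.smooth_factor.exp.mul C.smooth

lemma change_ne_zero (h : (x, y) ∈ Ω) : coordChange φ F x y ≠ 0 :=
  mul_ne_zero (Real.exp_ne_zero _) (C.ne_zero h)

lemma dy_change (h : (x, y) ∈ Ω) (i : Fin 2) : dy i (coordChange φ F) x y =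
    Real.exp (φ x y) * (dy i F x y + F x y * dy i φ x y) := by
  have := (((C.smooth_factor.hasDy C.isOpen h i).comp (Real.hasDerivAt_exp _)).mul
    (C.smooth.hasDy C.isOpen h i)).dy_eq
  refine Eq.trans this ?_
  ring

lemma dy_dy_change (h : (x, y) ∈ Ω) (i j : Fin 2) : dy i (dy j (coordChange φ F)) x y =
    Real.exp (φ x y) * (dy i φ x y * (dy j F x y + F x y * dy j φ x y)
      + dy i (dy j F) x y + dy i F x y * dy j φ x y + F x y * dy i (dy j φ) x y) := by
  rw [dy_congr C.isOpen (fun _ _ h => C.dy_change h j) h,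
    (((C.smooth_factor.hasDy C.isOpen h i).comp (Real.hasDerivAt_exp _)).mul
    (((C.smooth.dy C.isOpen j).hasDy C.isOpen h i).add ((C.smooth.hasDy C.isOpen h i).mul
      ((C.smooth_factor.dy C.isOpen j).hasDy C.isOpen h i)))).dy_eq]
  ring

lemma euler_change (h : (x, y) ∈ Ω) :
    ∑ i, y i * dy i (coordChange φ F) x y = coordChange φ F x y := by
  have h1 := C.euler h
  have h2 := C.euler_factor h
  simp only [C.dy_change h, coordChange, Fin.sum_univ_two] at *
  linear_combination Real.exp (φ x y) * (h1 + F x y * h2)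

/-- The non-degeneracy condition on `φ` makes the metric tensor of `e^φ F` invertible. -/
lemma det_change_ne_zero (h : (x, y) ∈ Ω) : (metric (coordChange φ F) x y).det ≠ 0 := by
  intro h0
  apply C.nondegenerate x y h
  have hd := C.det_ne x y h
  have hF := C.ne_zero h
  have hs := eps_sq hd
  have hr := invDensity_sq_mul_det hd
  have f1 := C.euler h
  have d1 := det_metric_mul_sq C.isOpen C.smooth (fun _ _ => C.euler) h (-dy 1 F x y) (dy 0 F x y)
  have d2 := det_metric_mul_sq C.isOpen C.smooth_change (fun _ _ => C.euler_change) h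
    (-dy 1 F x y) (dy 0 F x y)
  have s := dy_comm C.isOpen C.smooth_factor h 1 0
  simp only [h0, C.dy_dy_change h, coordChange, Fin.sum_univ_two, mUp_eq, conormal,
    Matrix.cons_val_zero, Matrix.cons_val_one, zero_mul, s] at *
  have f2 : y 0 * dy 0 F x y - y 1 * -dy 1 F x y = F x y := by linear_combination f1
  rw [f2] at d1
  have hE := Real.exp_ne_zero (φ x y)
  generalize Real.exp (φ x y) = E at *
  generalize invDensity F x y = r at *
  generalize eps F x y = ε at *
  generalize (metric F x y).det = d at *
  -- Both determinants are known on the span of `y` and the conormal `(-∂̇₂F, ∂̇₁F)`, on which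
  -- `∂̇ᵢF` contributes nothing; their comparison leaves the expression in the hypothesis.
  have d3 : (F x y) ^ 2 * E ^ 4 * (d + F x y ^ 2 * ((dy 0 (dy 0 φ) x y + dy 0 φ x y ^ 2)
      * dy 1 F x y ^ 2 - 2 * (dy 0 (dy 1 φ) x y + dy 0 φ x y * dy 1 φ x y) * dy 1 F x y
      * dy 0 F x y + (dy 1 (dy 1 φ) x y + dy 1 φ x y ^ 2) * dy 0 F x y ^ 2)) = 0 := by
    linear_combination -d2 + E ^ 4 * d1
  have d4 := (mul_eq_zero.1 d3).resolve_left
    (mul_ne_zero (pow_ne_zero _ hF) (pow_ne_zero _ hE))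
  linear_combination r ^ 2 * d4 - hr + (F x y ^ 2 * r ^ 2 * ((dy 0 (dy 0 φ) x y + dy 0 φ x y ^ 2)
      * dy 1 F x y ^ 2 - 2 * (dy 0 (dy 1 φ) x y + dy 0 φ x y * dy 1 φ x y) * dy 1 F x y
      * dy 0 F x y + (dy 1 (dy 1 φ) x y + dy 1 φ x y ^ 2) * dy 0 F x y ^ 2)) * hs

lemma smooth_delta_factor (k : Fin 2) : Sm Ω (delta F k φ) :=
  (C.smooth_factor.lift C.isOpen (ξ := e k) (C.hasWeight k).smooth_coeff).congr fun _ _ h =>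
    C.delta_eq C.smooth_factor h k

/-- The horizontal derivatives of `φ` do not vary along the fibres. -/
lemma vConst_delta_factor (k : Fin 2) : VConst Ω (delta F k φ) := fun x y h => by
  have W := C.hasWeight k
  have hΩ := C.isOpen
  have hl : ∀ x y, (x, y) ∈ Ω → delta F k φ x y = lift (e k) (connCoeff F k) φ x y :=
    fun _ _ h => C.delta_eq C.smooth_factor h k
  have hF := C.ne_zero h
  have h1 := W.lift_vDer2 C.smooth_factor h
  rw [← C.delta_eq (C.smooth.vDer2 hΩ C.smooth_factor C.det_ne) h, C.delta_vDer2 x y h,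
    vDer2_eq (C.det_ne x y h), ← dy_congr hΩ hl h, ← dy_congr hΩ hl h] at h1
  have h2 : dy 0 F x y * dy 1 (delta F k φ) x y - dy 1 F x y * dy 0 (delta F k φ) x y = 0 := by
    have := (mul_eq_zero.1 h1.symm).resolve_right (invDensity_ne_zero (C.det_ne x y h))
    exact (mul_eq_zero.1 this).resolve_left hF
  -- The Euler field commutes with `δₖ`, so `δₖ φ` is positively homogeneous of degree zero.
  have h3 : ∑ i, y i * dy i (delta F k φ) x y = 0 := by
    have d := fun i => FinslerSurface.lift_dy (ξ := e k) hΩ C.smooth_factor W.smooth_coeff W.coeff h i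
    have s : ∀ i, Sm Ω (dy i φ) := fun i => C.smooth_factor.dy hΩ i
    have E := (HasD.sum fun i => (HasD.coord i).mul ((s i).hasD_lift (ξ := e k)
      (N := connCoeff F k) hΩ h)).eq
    rw [D_congr hΩ (fun _ _ h => C.euler_factor h) h, (HasD.const 0).eq] at E
    rw [Fin.sum_univ_two, dy_congr hΩ hl h, dy_congr hΩ hl h]
    simp only [d, Fin.sum_univ_two] at E
    linear_combination -E
  have h4 := C.euler h
  simp only [Fin.sum_univ_two] at h3 h4
  have a0 : F x y * dy 0 (delta F k φ) x y = 0 := by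
    linear_combination (-dy 0 (delta F k φ) x y) * h4 + dy 0 F x y * h3 - y 1 * h2
  have a1 : F x y * dy 1 (delta F k φ) x y = 0 := by
    linear_combination (-dy 1 (delta F k φ) x y) * h4 + dy 1 F x y * h3 + y 0 * h2
  intro i
  fin_cases i
  · exact (mul_eq_zero.1 a0).resolve_left hF
  · exact (mul_eq_zero.1 a1).resolve_left hF

/-- `e^φ F` has weight `δₖ φ` under the horizontal derivation `δₖ` of `F`. -/
lemma hasWeight_change (k : Fin 2) :
    HasWeight Ω (e k) (connCoeff F k) (coordChange φ F) (delta F k φ) where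
  isOpen := C.isOpen
  smooth := C.smooth_change
  smooth_coeff := (C.hasWeight k).smooth_coeff
  coeff := (C.hasWeight k).coeff
  smooth_weight := C.smooth_delta_factor k
  weight := C.vConst_delta_factor k
  det_ne _ _ := C.det_change_ne_zero
  eq x y h := by
    have := (((C.smooth_factor.hasD_lift (ξ := e k) (N := connCoeff F k) C.isOpen h).comp
      (Real.hasDerivAt_exp _)).mul (C.smooth.hasD_lift (ξ := e k) (N := connCoeff F k)
      C.isOpen h)).eq
    refine Eq.trans this ?_
    rw [C.delta_self h, C.delta_eq C.smooth_factor h, coordChange]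
    ring

lemma smooth_mainScalar : Sm Ω (mainScalar (coordChange φ F)) :=
  C.smooth_change.mainScalar C.isOpen fun _ _ => C.det_change_ne_zero

lemma smooth_tScalar : Sm Ω (tScalar φ F) :=
  C.smooth_change.vDer2 C.isOpen C.smooth_mainScalar fun _ _ => C.det_change_ne_zero

lemma delta_mainScalar (h : (x, y) ∈ Ω) (k : Fin 2) :
    delta F k (mainScalar (coordChange φ F)) x y = 0 := by
  rw [C.delta_eq C.smooth_mainScalar h, (C.hasWeight_change k).lift_mainScalar h]

/-- The scalar governing the `T`-tensor of `e^φ F` is horizontally constant. -/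
lemma delta_tScalar (h : (x, y) ∈ Ω) (k : Fin 2) : delta F k (tScalar φ F) x y = 0 := by
  rw [C.delta_eq C.smooth_tScalar h, tScalar, (C.hasWeight_change k).lift_vDer2 C.smooth_mainScalar h,
    vDer2_eq (C.det_change_ne_zero h)]
  have h0 : ∀ x y, (x, y) ∈ Ω →
      lift (e k) (connCoeff F k) (mainScalar (coordChange φ F)) x y = 0 :=
    fun _ _ h => (C.hasWeight_change k).lift_mainScalar h
  have h1 : ∀ i, dy i (lift (e k) (connCoeff F k) (mainScalar (coordChange φ F))) x y = 0 :=
    fun i => by rw [dy_congr C.isOpen h0 h]; exact (HasD.const 0).dy_eq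
  rw [h1, h1]; ring

/-- The difference of the sprays of `e^φ F` and `F`. -/
lemma sprayCoeff_change (h : (x, y) ∈ Ω) (l : Fin 2) :
    2 * ∑ i, metric (coordChange φ F) x y l i *
        (sprayCoeff (coordChange φ F) i x y - sprayCoeff F i x y) =
      coordChange φ F x y * (2 * (∑ k, y k * delta F k φ x y) * dy l (coordChange φ F) x y
        - delta F l φ x y * coordChange φ F x y) := by
  set K := coordChange φ F with hK
  have hΩ := C.isOpen
  have sK := C.smooth_change
  have sH := sK.pow 2
  have W := C.hasWeight_change
  have hu : IsUnit (metric K x y).det := isUnit_iff_ne_zero.2 (C.det_change_ne_zero h)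
  -- Lowering the index in the definition of the spray.
  have h1 : ∑ i, metric K x y l i * sprayCoeff K i x y = (1 / 4) *
      ((∑ k, y k * dx k (dy l fun x y => K x y ^ 2) x y) - dx l (fun x y => K x y ^ 2) x y) := by
    have q : ∀ v : Fin 2 → ℝ, ∑ i, metric K x y l i * ((1 / 4) * ∑ m, (metric K x y)⁻¹ i m * v m)
        = (1 / 4) * v l := by
      intro v
      have a : ∀ b, ∑ j, metric K x y l j * (metric K x y)⁻¹ j b
          = (1 : Matrix (Fin 2) (Fin 2) ℝ) l b := fun b => by
        rw [← Matrix.mul_nonsing_inv _ hu, Matrix.mul_apply]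
      have a0 := a 0
      have a1 := a 1
      have a2 : (1 : Matrix (Fin 2) (Fin 2) ℝ) l 0 * v 0 + (1 : Matrix (Fin 2) (Fin 2) ℝ) l 1 * v 1
          = v l := by fin_cases l <;> simp [Matrix.one_apply]
      simp only [Fin.sum_univ_two] at *
      linear_combination (1 / 4) * (v 0 * a0 + v 1 * a1 + a2)
    exact q _
  -- `∂ₖ` is expressed by `δₖ` and the vertical derivatives.
  have h2 : ∀ k, dx k (dy l fun x y => K x y ^ 2) x y =
      2 * delta F k φ x y * dy l (fun x y => K x y ^ 2) x y
      + ∑ j, christoffel F j k l x y * dy j (fun x y => K x y ^ 2) x y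
      + ∑ j, barthel F j k x y * (2 * metric K x y j l) := by
    intro k
    have a := C.delta_eq (sH.dy hΩ l) h k
    rw [(W k).lift_dy_sq h l, delta] at a
    simp only [metric_apply, connCoeff, Fin.sum_univ_two] at a ⊢
    linear_combination a
  have h3 : dx l (fun x y => K x y ^ 2) x y = 2 * delta F l φ x y * K x y ^ 2
      + ∑ j, barthel F j l x y * dy j (fun x y => K x y ^ 2) x y := by
    have a := C.delta_eq sH h l
    rw [(W l).lift_sq h, delta] at a
    linear_combination a
  have h4 : ∀ j, dy j (fun x y => K x y ^ 2) x y = 2 * K x y * dy j K x y :=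
    fun j => (sK.hasDy hΩ h j).pow_two.dy_eq
  have h5 := metric_symm hΩ sK h
  have h6 : ∀ j, ∑ k, y k * barthel F j k x y = 2 * sprayCoeff F j x y := fun j => by
    simp only [C.barthel_eq h, C.sprayCoeff_eq h, Fin.sum_univ_two]
    ring
  have h7 : ∀ j, ∑ k, y k * christoffel F j k l x y = barthel F j l x y := fun j => by
    simp only [C.barthel_eq h, Fin.sum_univ_two, C.christoffel_symm h j _ l]
    ring
  have h60 := h6 0
  have h61 := h6 1
  have h70 := h7 0
  have h71 := h7 1
  have h50 : metric K x y 0 l = metric K x y l 0 := h5 0 l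
  have h51 : metric K x y 1 l = metric K x y l 1 := h5 1 l
  clear h5 h6 h7
  simp only [h2, h3, h4, Fin.sum_univ_two] at *
  rw [h50, h51] at h1
  linear_combination 2 * h1 + K x y * dy 0 K x y * h70 + K x y * dy 1 K x y * h71
    + metric K x y l 0 * h60 + metric K x y l 1 * h61

/-- The Landsberg scalar of `e^φ F` is, up to a nowhere vanishing factor, the product of the
scalar governing its `T`-tensor and the defect of the relation `φ_{;2} φ_{,1} = φ_{,2}`. -/
lemma landsberg_iff (h : (x, y) ∈ Ω) : landsbergScalar (coordChange φ F) x y = 0 ↔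
    tScalar φ F x y = 0 ∨ defect φ F x y = 0 := by
  have hK := C.change_ne_zero h
  have hd := C.det_change_ne_zero h
  have hr := invDensity_ne_zero hd
  have hΩ := C.isOpen
  have s := C.sprayCoeff_change h
  have s0 := s 0
  have s1 := s 1
  have ms := metric_symm hΩ C.smooth_change h 1 0
  have m := metric_mulVec hΩ C.smooth_change (fun _ _ => C.euler_change) h
  have m0 := m 0
  have m1 := m 1
  have eK := C.euler_change h
  have eI := euler_mainScalar hΩ C.smooth_change (fun _ _ => C.det_change_ne_zero)
    (fun _ _ => C.euler_change) h
  have L : landsbergScalar (coordChange φ F) x y = -2 * ∑ j,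
      (sprayCoeff (coordChange φ F) j x y - sprayCoeff F j x y)
        * dy j (mainScalar (coordChange φ F)) x y := by
    have a0 := C.delta_mainScalar h 0
    have a1 := C.delta_mainScalar h 1
    have b0 := C.sprayCoeff_eq h 0
    have b1 := C.sprayCoeff_eq h 1
    simp only [landsbergScalar, spray, delta, C.barthel_eq h, b0, b1, Fin.sum_univ_two] at *
    linear_combination y 0 * a0 + y 1 * a1
  have T : tScalar φ F x y = coordChange φ F x y * (dy 0 (coordChange φ F) x y *
      dy 1 (mainScalar (coordChange φ F)) x y - dy 1 (coordChange φ F) x y *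
      dy 0 (mainScalar (coordChange φ F)) x y) * invDensity (coordChange φ F) x y := vDer2_eq hd
  have key : landsbergScalar (coordChange φ F) x y * (metric (coordChange φ F) x y).det =
      (dy 0 (coordChange φ F) x y * dy 1 (mainScalar (coordChange φ F)) x y
        - dy 1 (coordChange φ F) x y * dy 0 (mainScalar (coordChange φ F)) x y)
      * coordChange φ F x y ^ 2 * defect φ F x y := by
    rw [L, defect, Matrix.det_fin_two]
    simp only [Fin.sum_univ_two, ms] at *
    generalize metric (coordChange φ F) x y 0 0 = a at *
    generalize metric (coordChange φ F) x y 0 1 = b at *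
    generalize metric (coordChange φ F) x y 1 1 = c at *
    generalize dy 0 (mainScalar (coordChange φ F)) x y = i0 at *
    generalize dy 1 (mainScalar (coordChange φ F)) x y = i1 at *
    generalize dy 0 (coordChange φ F) x y = k0 at *
    generalize dy 1 (coordChange φ F) x y = k1 at *
    generalize sprayCoeff (coordChange φ F) 0 x y - sprayCoeff F 0 x y = d0 at *
    generalize sprayCoeff (coordChange φ F) 1 x y - sprayCoeff F 1 x y = d1 at *
    generalize delta F 0 φ x y = c0 at *
    generalize delta F 1 φ x y = c1 at *
    generalize coordChange φ F x y = K at *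
    -- By Euler's relations `∂̇ᵢĪ` is a multiple of `(-y², y¹)`, so only this component of the
    -- difference of the sprays matters; Cramer's rule gives it as `t2`.
    have t0 : K * i0 = -(y 1) * (k0 * i1 - k1 * i0) := by
      linear_combination k0 * eI - i0 * eK
    have t1 : K * i1 = y 0 * (k0 * i1 - k1 * i0) := by
      linear_combination k1 * eI - i1 * eK
    have t2 : 2 * (a * c - b * b) * (y 0 * d1 - y 1 * d0) = -K ^ 3 * (k0 * c1 - k1 * c0) := by
      linear_combination (a * y 0 + b * y 1) * s1 - (b * y 0 + c * y 1) * s0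
        + K * (2 * (y 0 * c0 + y 1 * c1) * k1 - c1 * K) * m0
        - K * (2 * (y 0 * c0 + y 1 * c1) * k0 - c0 * K) * m1
    apply mul_left_cancel₀ hK
    linear_combination (-2 * (a * c - b * b)) * (d0 * t0 + d1 * t1) - (k0 * i1 - k1 * i0) * t2
  rw [T]
  constructor
  · intro hL
    rw [hL, zero_mul] at key
    rcases mul_eq_zero.1 key.symm with h1 | h1
    · left
      have := (mul_eq_zero.1 h1).resolve_right (pow_ne_zero _ hK)
      rw [this]; ring
    · exact Or.inr h1
  · intro h1
    refine (mul_eq_zero.1 ?_).resolve_right hd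
    rw [key]
    rcases h1 with h1 | h1
    · have := (mul_eq_zero.1 ((mul_eq_zero.1 h1).resolve_right hr)).resolve_left hK
      rw [this]; ring
    · rw [h1, mul_zero]

lemma relation_iff (h : (x, y) ∈ Ω) :
    vDer2 F φ x y * hDer1 F φ x y = hDer2 F φ x y ↔ defect φ F x y = 0 := by
  have hd := C.det_ne x y h
  have hr := invDensity_ne_zero hd
  have hF := C.ne_zero h
  have hE := Real.exp_ne_zero (φ x y)
  have e1 := C.euler h
  have e2 := C.euler_factor h
  have key : Real.exp (φ x y) * (vDer2 F φ x y * hDer1 F φ x y - hDer2 F φ x y)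
      = -(invDensity F x y * defect φ F x y) := by
    rw [vDer2_eq hd, hDer2_eq hd, defect, C.dy_change h, C.dy_change h]
    simp only [hDer1, ellUp, Fin.sum_univ_two] at *
    field_simp
    linear_combination ((delta F 0 φ x y) * dy 1 φ x y - delta F 1 φ x y * dy 0 φ x y) * e1
      + (dy 0 F x y * delta F 1 φ x y - dy 1 F x y * delta F 0 φ x y) * e2
  rw [← sub_eq_zero]
  constructor
  · intro h1
    rw [h1, mul_zero, eq_comm, neg_eq_zero] at key
    exact (mul_eq_zero.1 key).resolve_left hr
  · intro h1
    rw [h1, mul_zero, neg_zero] at key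
    exact (mul_eq_zero.1 key).resolve_left hE

lemma tTensor_iff (hy : y ≠ 0) (h : (x, y) ∈ Ω) :
    (∀ i j k l, tTensor (coordChange φ F) i j k l x y = 0) ↔ tScalar φ F x y = 0 := by
  constructor
  · intro h0
    have hK := C.change_ne_zero h
    have hd := C.det_change_ne_zero h
    obtain ⟨i, hi⟩ : ∃ i, y i ≠ 0 := by
      by_contra! hc
      exact hy (by ext i; simpa using hc i)
    obtain ⟨j, hj⟩ : ∃ j, mLow (coordChange φ F) j x y ≠ 0 := by
      have hs : √|(metric (coordChange φ F) x y).det| ≠ 0 :=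
        (Real.sqrt_ne_zero (abs_nonneg _)).2 (abs_ne_zero.2 hd)
      fin_cases i
      · exact ⟨1, by simpa [mLow, eps_mul_det, ellUp, hK] using ⟨hd, hi⟩⟩
      · exact ⟨0, by simpa [mLow, eps_mul_det, ellUp, hK] using ⟨hd, hi⟩⟩
    have := h0 j j j j
    simpa [tTensor, hK, hj, tScalar] using this
  · intro h0 i j k l
    have : vDer2 (coordChange φ F) (mainScalar (coordChange φ F)) x y = 0 := h0
    simp [tTensor, this]

/-- The relation `φ_{;2} φ_{,1} = φ_{,2}` on an open set forces `φ` to be horizontally constant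
there. -/
lemma delta_factor_eq_zero {Ω' : Set (E2 × E2)} (hΩ' : IsOpen Ω') (hsub : Ω' ⊆ Ω)
    (h0 : ∀ x y, (x, y) ∈ Ω' → defect φ F x y = 0) (h : (x, y) ∈ Ω') (k : Fin 2) :
    delta F k φ x y = 0 := by
  have hΩ := C.isOpen
  have h' := hsub h
  have hd := C.det_change_ne_zero h'
  have v := fun k => C.vConst_delta_factor k x y h'
  have b := h0 x y h
  have s := C.smooth_delta_factor
  have sK := fun i => C.smooth_change.dy hΩ i
  -- Vertical differentiation of the relation: `(δ₂φ, -δ₁φ)` lies in the kernel of the metric tensor.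
  have b1 : ∀ j, dy j (dy 0 (coordChange φ F)) x y * delta F 1 φ x y
      - dy j (dy 1 (coordChange φ F)) x y * delta F 0 φ x y = 0 := by
    intro j
    have a := ((((sK 0).hasDy hΩ h' j).mul ((s 1).hasDy hΩ h' j)).sub
      (((sK 1).hasDy hΩ h' j).mul ((s 0).hasDy hΩ h' j))).dy_eq
    rw [v, v] at a
    change dy j (defect φ F) x y = _ at a
    have a' : dy j (defect φ F) x y = 0 := by
      rw [dy_congr hΩ' h0 h]; exact (HasD.const 0).dy_eq
    linear_combination a' - a
  have g : ∀ j, metric (coordChange φ F) x y j 0 * delta F 1 φ x y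
      - metric (coordChange φ F) x y j 1 * delta F 0 φ x y = 0 := by
    intro j
    rw [metric_eq hΩ C.smooth_change h', metric_eq hΩ C.smooth_change h']
    rw [defect] at b
    linear_combination dy j (coordChange φ F) x y * b + coordChange φ F x y * b1 j
  have g0 := g 0
  have g1 := g 1
  rw [Matrix.det_fin_two] at hd
  fin_cases k
  · refine (mul_eq_zero.1 ?_).resolve_left hd
    simp only [Fin.zero_eta]
    linear_combination metric (coordChange φ F) x y 1 0 * g0
      - metric (coordChange φ F) x y 0 0 * g1
  · refine (mul_eq_zero.1 ?_).resolve_left hd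
    simp only [Fin.mk_one]
    linear_combination metric (coordChange φ F) x y 1 1 * g0
      - metric (coordChange φ F) x y 0 1 * g1

end CoordChange

/-! ### Linear changes of the fibre coordinates -/

section FibreChange

variable {Ω : Set (E2 × E2)} {f K : E2 → E2 → ℝ} {x y : E2} (L : E2 ≃L[ℝ] E2)

/-- A function in fibre coordinates transformed by the linear map `L`. -/
def pull (f : E2 → E2 → ℝ) (x y : E2) : ℝ := f x (L y)

/-- The entries of the matrix of `L`. -/
def entry (i j : Fin 2) : ℝ := L (e j) i

/-- The determinant of `L`. -/
def entryDet : ℝ := entry L 0 0 * entry L 1 1 - entry L 0 1 * entry L 1 0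

/-- The part of the coordinate tangent bundle which `L` maps to `Ω`. -/
def pullSet (Ω : Set (E2 × E2)) : Set (E2 × E2) := (fun z => (z.1, L z.2)) ⁻¹' Ω

lemma contDiff_fibreMap : ContDiff ℝ ∞ fun z : E2 × E2 => (z.1, L z.2) :=
  contDiff_fst.prodMk (L.contDiff.comp contDiff_snd)

lemma isOpen_pullSet (hΩ : IsOpen Ω) : IsOpen (pullSet L Ω) :=
  hΩ.preimage (contDiff_fibreMap L).continuous

lemma Sm.pull (hf : Sm Ω f) : Sm (pullSet L Ω) (pull L f) :=
  ContDiffOn.comp (g := fun z : E2 × E2 => f z.1 z.2) hf (contDiff_fibreMap L).contDiffOn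
    fun _ h => h

lemma entryDet_ne_zero : entryDet L ≠ 0 := by
  intro h0
  have h1 : ∀ a b : ℝ, L (a • e 0 + b • e 1) = 0 → a = 0 ∧ b = 0 := by
    intro a b hab
    have := (L.map_eq_zero_iff).1 hab
    have c0 := congrArg (fun v : E2 => v 0) this
    have c1 := congrArg (fun v : E2 => v 1) this
    simp at c0 c1
    exact ⟨c0, c1⟩
  have h2 : L (entry L 1 1 • e 0 + (-entry L 1 0) • e 1) = 0 := by
    ext i
    rw [map_add, map_smul, map_smul]
    fin_cases i
    · simp [entry]; simp [entryDet, entry] at h0; linear_combination h0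
    · simp [entry]; ring
  have h3 : L (entry L 0 1 • e 0 + (-entry L 0 0) • e 1) = 0 := by
    ext i
    rw [map_add, map_smul, map_smul]
    fin_cases i
    · simp [entry]; ring
    · simp [entry]; simp [entryDet, entry] at h0; linear_combination -h0
  obtain ⟨a, b⟩ := h1 _ _ h2
  obtain ⟨c, d⟩ := h1 _ _ h3
  have h4 : L (e 0) = 0 := by
    ext i
    fin_cases i
    · simpa [entry] using d
    · simpa [entry] using b
  have h5 := congrArg (fun v : E2 => v 0) ((L.map_eq_zero_iff).1 h4)
  simp at h5

lemma dy_pull (i : Fin 2) : dy i (pull L f) x y = ∑ j, entry L j i * dy j f x (L y) := by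
  unfold dy
  rw [show (fun y' => pull L f x y') = (fun y' => f x y') ∘ L from rfl, L.comp_right_fderiv]
  simp only [ContinuousLinearMap.comp_apply, ContinuousLinearEquiv.coe_coe]
  conv_lhs => rw [sum_e (L (EuclideanSpace.single i 1))]
  simp only [map_sum, map_smul, smul_eq_mul]
  rfl

lemma metric_pull (hΩ : IsOpen Ω) (hK : Sm Ω K) (h : (x, y) ∈ pullSet L Ω) (i j : Fin 2) :
    metric (pull L K) x y i j =
      ∑ b, ∑ a, entry L b j * (entry L a i * metric K x (L y) a b) := by
  have h1 : ∀ x y, (x, y) ∈ pullSet L Ω → dy j (fun x y => pull L K x y ^ 2) x y =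
      ∑ b, entry L b j * pull L (dy b fun x y => K x y ^ 2) x y := fun x y _ =>
    dy_pull (f := fun x y => K x y ^ 2) L j
  have s := fun b => (((hK.pow 2).dy hΩ b).pull L).hasDy (isOpen_pullSet L hΩ) h i
  rw [metric_apply, dy_congr (isOpen_pullSet L hΩ) h1 h,
    (HasD.sum fun b => (HasD.const (entry L b j)).mul (s b)).dy_eq]
  simp only [dy_pull, metric_apply, Fin.sum_univ_two]
  ring

lemma cartan_pull (hΩ : IsOpen Ω) (hK : Sm Ω K) (h : (x, y) ∈ pullSet L Ω) (i j k : Fin 2) :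
    cartan (pull L K) i j k x y = ∑ b, ∑ a, ∑ c,
      entry L b j * (entry L a i * (entry L c k * cartan K a b c x (L y))) := by
  have s := fun a b => (((hK.metric hΩ a b)).pull L).hasDy (isOpen_pullSet L hΩ) h k
  rw [cartan, dy_congr (isOpen_pullSet L hΩ)
    (fun _ _ h => metric_pull L hΩ hK h i j) h]
  have := (HasD.sum fun b => HasD.sum fun a => (HasD.const (entry L b j)).mul
    ((HasD.const (entry L a i)).mul (s a b))).dy_eq
  refine Eq.trans (congrArg _ this) ?_
  simp only [dy_pull, cartan, Fin.sum_univ_two]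
  ring

lemma det_pull (hΩ : IsOpen Ω) (hK : Sm Ω K) (h : (x, y) ∈ pullSet L Ω) :
    (metric (pull L K) x y).det = entryDet L ^ 2 * (metric K x (L y)).det := by
  rw [Matrix.det_fin_two, Matrix.det_fin_two]
  simp only [metric_pull L hΩ hK h, Fin.sum_univ_two, entryDet]
  ring

lemma invDensity_pull (hΩ : IsOpen Ω) (hK : Sm Ω K) (h : (x, y) ∈ pullSet L Ω) :
    invDensity (pull L K) x y = |entryDet L|⁻¹ * invDensity K x (L y) := by
  rw [invDensity, det_pull L hΩ hK h, abs_mul, abs_pow, Real.sqrt_mul (by positivity),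
    Real.sqrt_sq (abs_nonneg _), mul_inv, invDensity]

/-- The sign of the determinant of `L`. -/
def orientation : ℝ := entryDet L * |entryDet L|⁻¹

lemma orientation_sq : orientation L * orientation L = 1 := by
  have h := entryDet_ne_zero L
  have h' := abs_ne_zero.2 h
  have := abs_mul_abs_self (entryDet L)
  rw [orientation]
  field_simp
  rw [pow_two, pow_two, this]

lemma vDer2_pull (hΩ : IsOpen Ω) (hK : Sm Ω K)
    (hdet : ∀ x y, (x, y) ∈ Ω → (metric K x y).det ≠ 0) (h : (x, y) ∈ pullSet L Ω) :
    vDer2 (pull L K) (pull L f) x y = orientation L * vDer2 K f x (L y) := by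
  have hd := hdet x (L y) h
  have hd' : (metric (pull L K) x y).det ≠ 0 := by
    rw [det_pull L hΩ hK h]; exact mul_ne_zero (pow_ne_zero _ (entryDet_ne_zero L)) hd
  rw [vDer2_eq hd', vDer2_eq hd, invDensity_pull L hΩ hK h, orientation]
  simp only [dy_pull, Fin.sum_univ_two, pull]
  generalize |entryDet L|⁻¹ = a
  rw [entryDet]
  ring

lemma mainScalar_pull (hΩ : IsOpen Ω) (hK : Sm Ω K)
    (hdet : ∀ x y, (x, y) ∈ Ω → (metric K x y).det ≠ 0) (h : (x, y) ∈ pullSet L Ω) :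
    mainScalar (pull L K) x y = orientation L * mainScalar K x (L y) := by
  have hd := hdet x (L y) h
  have hd' : (metric (pull L K) x y).det ≠ 0 := by
    rw [det_pull L hΩ hK h]; exact mul_ne_zero (pow_ne_zero _ (entryDet_ne_zero L)) hd
  have ho := orientation_sq L
  have c0 : ∑ i, entry L 0 i * conormal (pull L K) i x y
      = entryDet L * conormal K 0 x (L y) := by
    simp [conormal, dy_pull, entryDet]; ring
  have c1 : ∑ i, entry L 1 i * conormal (pull L K) i x y
      = entryDet L * conormal K 1 x (L y) := by
    simp [conormal, dy_pull, entryDet]; ring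
  rw [mainScalar_eq hd', mainScalar_eq hd, invDensity_pull L hΩ hK h]
  simp only [cartan_pull L hΩ hK h, Fin.sum_univ_two] at *
  simp only [orientation] at *
  generalize |entryDet L|⁻¹ = a at *
  generalize conormal (pull L K) 0 x y = n0 at *
  generalize conormal (pull L K) 1 x y = n1 at *
  generalize cartan K 0 0 0 x (L y) = C000
  generalize cartan K 0 0 1 x (L y) = C001
  generalize cartan K 0 1 0 x (L y) = C010
  generalize cartan K 0 1 1 x (L y) = C011
  generalize cartan K 1 0 0 x (L y) = C100
  generalize cartan K 1 0 1 x (L y) = C101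
  generalize cartan K 1 1 0 x (L y) = C110
  generalize cartan K 1 1 1 x (L y) = C111
  rw [show pull L K x y = K x (L y) from rfl]
  generalize K x (L y) = k
  generalize invDensity K x (L y) = r
  -- The trilinear form is evaluated on the image of the conormal under `L`.
  have e3 : ∀ u v : ℝ, u = (entryDet L * conormal K 0 x (L y)) →
      v = (entryDet L * conormal K 1 x (L y)) →
      k * (C000 * u * u * u + C001 * u * u * v + C010 * u * v * u + C011 * u * v * v
        + C100 * v * u * u + C101 * v * u * v + C110 * v * v * u + C111 * v * v * v)
        * (a * r * (a * r) * (a * r)) = entryDet L * a * (k * (C000 * (conormal K 0 x (L y)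
        * conormal K 0 x (L y) * conormal K 0 x (L y)) + C001 * (conormal K 0 x (L y)
        * conormal K 0 x (L y) * conormal K 1 x (L y)) + (C010 * (conormal K 0 x (L y)
        * conormal K 1 x (L y) * conormal K 0 x (L y)) + C011 * (conormal K 0 x (L y)
        * conormal K 1 x (L y) * conormal K 1 x (L y))) + (C100 * (conormal K 1 x (L y)
        * conormal K 0 x (L y) * conormal K 0 x (L y)) + C101 * (conormal K 1 x (L y)
        * conormal K 0 x (L y) * conormal K 1 x (L y)) + (C110 * (conormal K 1 x (L y)
        * conormal K 1 x (L y) * conormal K 0 x (L y)) + C111 * (conormal K 1 x (L y)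
        * conormal K 1 x (L y) * conormal K 1 x (L y))))) * (r * r * r)) := by
    rintro u v rfl rfl
    generalize conormal K 0 x (L y) = m0
    generalize conormal K 1 x (L y) = m1
    linear_combination (entryDet L * a * (k * (C000 * m0 * m0 * m0 + C001 * m0 * m0 * m1
      + C010 * m0 * m1 * m0 + C011 * m0 * m1 * m1 + C100 * m1 * m0 * m0 + C101 * m1 * m0 * m1
      + C110 * m1 * m1 * m0 + C111 * m1 * m1 * m1) * (r * r * r))) * ho
  rw [← e3 _ _ c0 c1]
  ring

end FibreChange

lemma dy_fibre {f f' : E2 → E2 → ℝ} {x x' : E2} (h : f x = f' x') (i : Fin 2) :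
    dy i f x = dy i f' x' := by
  funext y; unfold dy; simp only [h]

lemma metric_fibre {f f' : E2 → E2 → ℝ} {x x' : E2} (h : f x = f' x') :
    metric f x = metric f' x' := by
  funext y
  ext i j
  rw [metric_apply, metric_apply]
  have h2 : (fun x y => f x y ^ 2) x = (fun x y => f' x y ^ 2) x' := by simp only [h]
  have h3 := dy_fibre (f := fun x y => f x y ^ 2) (f' := fun x y => f' x y ^ 2) h2 j
  rw [dy_fibre h3 i]

lemma mUp_fibre {f f' : E2 → E2 → ℝ} {x x' : E2} (h : f x = f' x') (i : Fin 2) :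
    mUp f i x = mUp f' i x' := by
  funext y
  simp only [mUp, eps, metric_fibre h, ellLow, dy_fibre h]

lemma mainScalar_fibre {f f' : E2 → E2 → ℝ} {x x' : E2} (h : f x = f' x') :
    mainScalar f x = mainScalar f' x' := by
  funext y
  have : ∀ i j k, cartan f i j k x = cartan f' i j k x' := fun i j k => by
    funext y
    have hm : (fun x y => metric f x y i j) x = (fun x y => metric f' x y i j) x' := by
      simp only [metric_fibre h]
    have h3 := dy_fibre (f := fun x y => metric f x y i j) (f' := fun x y => metric f' x y i j) hm k
    rw [cartan, cartan, h3]
  simp only [mainScalar, eps, metric_fibre h, mUp_fibre h, h, this]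

lemma vDer2_fibre {f f' g g' : E2 → E2 → ℝ} {x x' : E2} (h : f x = f' x') (hg : g x = g' x') :
    vDer2 f g x = vDer2 f' g' x' := by
  funext y
  simp only [vDer2, eps, metric_fibre h, mUp_fibre h, h, dy_fibre hg]

/-- The scalar governing the `T`-tensor is invariant under linear changes of the fibre coordinates,
of either orientation: both the main scalar and the vertical scalar derivative change by the sign
of the determinant. -/
lemma tScalar_fibreChange {Ω' : Set (E2 × E2)} {F φ F' φ' : E2 → E2 → ℝ} {x x' y : E2}
    (C : CoordChange Ω' F' φ') (L : E2 ≃L[ℝ] E2) (hF : ∀ y, F x y = F' x' (L y))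
    (hφ : ∀ y, φ x y = φ' x' (L y)) (h : (x', L y) ∈ Ω') :
    tScalar φ F x y = tScalar φ' F' x' (L y) := by
  have hΩ := C.isOpen
  have hK := C.smooth_change
  have hdet : ∀ x y, (x, y) ∈ Ω' → (metric (coordChange φ' F') x y).det ≠ 0 :=
    fun _ _ => C.det_change_ne_zero
  have h1 : coordChange φ F x = pull L (coordChange φ' F') x' := by
    funext y; simp [coordChange, pull, hF, hφ]
  have h' : (x', y) ∈ pullSet L Ω' := h
  have h2 := vDer2_fibre h1 (mainScalar_fibre h1)
  rw [tScalar, h2]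
  have hI := C.smooth_mainScalar
  have h3 : ∀ i, dy i (mainScalar (pull L (coordChange φ' F'))) x' y =
      orientation L * dy i (pull L (mainScalar (coordChange φ' F'))) x' y := fun i => by
    rw [dy_congr (isOpen_pullSet L hΩ) (fun _ _ h => mainScalar_pull L hΩ hK hdet h) h']
    have := ((HasD.const (orientation L)).mul
      ((hI.pull L).hasDy (isOpen_pullSet L hΩ) h' i)).dy_eq
    simp only [zero_mul, zero_add] at this
    exact this
  have h4 : vDer2 (pull L (coordChange φ' F')) (mainScalar (pull L (coordChange φ' F'))) x' y =
      orientation L *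
        vDer2 (pull L (coordChange φ' F')) (pull L (mainScalar (coordChange φ' F'))) x' y := by
    simp only [vDer2, h3, Fin.sum_univ_two]
    ring
  rw [h4, vDer2_pull L hΩ hK hdet h', ← mul_assoc, orientation_sq, one_mul, tScalar]

/-! ### Coordinates of the tangent bundle -/

section Coordinates

variable {M : Type*} [TopologicalSpace M] [ChartedSpace E2 M]
  {c c' : OpenPartialHomeomorph M E2} {A : Set (TangentBundle 𝓘(ℝ, E2) M)}
  {f : TangentBundle 𝓘(ℝ, E2) M → ℝ}

lemma contMDiff_modelTangent : ContMDiff 𝓘(ℝ, E2 × E2) 𝓘(ℝ, E2).tangent ∞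
    (fun z : E2 × E2 => (⟨z.1, z.2⟩ : TangentBundle 𝓘(ℝ, E2) E2)) := by
  have := contMDiff_tangentBundleModelSpaceHomeomorph_symm (I := 𝓘(ℝ, E2)) (n := ∞)
  rw [modelWithCornersSelf_prod]
  exact this

/-- The coordinates of the points of `A`. -/
def coordSet (c : OpenPartialHomeomorph M E2) (A : Set (TangentBundle 𝓘(ℝ, E2) M)) :
    Set (E2 × E2) := {z | z.1 ∈ c.target ∧ ofCoord c z.1 z.2 ∈ A}

lemma mdifferentiable_chart_of_mem (hc : c ∈ IsManifold.maximalAtlas 𝓘(ℝ, E2) ∞ M) :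
    c.MDifferentiable 𝓘(ℝ, E2) 𝓘(ℝ, E2) :=
  ⟨(contMDiffOn_of_mem_maximalAtlas hc).mdifferentiableOn (by simp),
    (contMDiffOn_symm_of_mem_maximalAtlas hc).mdifferentiableOn (by simp)⟩

lemma tangentBundle_ext {p q : M} {v : TangentSpace 𝓘(ℝ, E2) p} {w : TangentSpace 𝓘(ℝ, E2) q}
    (h : q = p) (hw : (w : E2) = (v : E2)) :
    (⟨q, w⟩ : TangentBundle 𝓘(ℝ, E2) M) = ⟨p, v⟩ := by
  subst h
  cases hw
  rfl

lemma baseCoord_ofCoord {x : E2} (hx : x ∈ c.target) (y : E2) :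
    baseCoord c (ofCoord c x y) = x := c.right_inv hx

lemma proj_ofCoord_mem {x : E2} (hx : x ∈ c.target) (y : E2) :
    (ofCoord c x y).proj ∈ c.source := c.map_target hx

lemma ofCoord_smul (c : OpenPartialHomeomorph M E2) (x y : E2) (t : ℝ) :
    ofCoord c x (t • y) = ⟨(ofCoord c x y).proj, t • (ofCoord c x y).2⟩ := by
  simp only [ofCoord, tangentMap]
  congr 1
  exact map_smul _ t y

lemma ofCoord_coord (hc : c ∈ IsManifold.maximalAtlas 𝓘(ℝ, E2) ∞ M)
    {u : TangentBundle 𝓘(ℝ, E2) M} (hu : u.proj ∈ c.source) :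
    ofCoord c (baseCoord c u) (fibreCoord c u) = u := by
  have h := (mdifferentiable_chart_of_mem hc).symm_comp_deriv hu
  refine tangentBundle_ext (c.left_inv hu) ?_
  exact congrArg (fun T => T u.2) h

lemma fibreCoord_ofCoord (hc : c ∈ IsManifold.maximalAtlas 𝓘(ℝ, E2) ∞ M) {x : E2}
    (hx : x ∈ c.target) (y : E2) : fibreCoord c (ofCoord c x y) = y := by
  have h := (mdifferentiable_chart_of_mem hc).comp_symm_deriv hx
  exact congrArg (fun T => T y) h

lemma coord_mem (hc : c ∈ IsManifold.maximalAtlas 𝓘(ℝ, E2) ∞ M) {u : TangentBundle 𝓘(ℝ, E2) M}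
    (hu : u ∈ A) (hp : u.proj ∈ c.source) : (baseCoord c u, fibreCoord c u) ∈ coordSet c A :=
  ⟨c.map_source hp, by simpa only [ofCoord_coord hc hp] using hu⟩

lemma fibreCoord_ne_zero {u : TangentBundle 𝓘(ℝ, E2) M} {x y : E2} (h : ofCoord c x y = u)
    (hu : u.2 ≠ 0) : y ≠ 0 := by
  rintro rfl
  subst h
  exact hu (map_zero (mfderiv 𝓘(ℝ, E2) 𝓘(ℝ, E2) c.symm x))

/-- The change of fibre coordinates between two charts at a point. -/
lemma exists_fibreChange (hc : c ∈ IsManifold.maximalAtlas 𝓘(ℝ, E2) ∞ M)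
    (hc' : c' ∈ IsManifold.maximalAtlas 𝓘(ℝ, E2) ∞ M) {p : M} (hp : p ∈ c.source)
    (hp' : p ∈ c'.source) :
    ∃ L : E2 ≃L[ℝ] E2, ∀ y, ofCoord c (c p) y = ofCoord c' (c' p) (L y) := by
  let T : TangentSpace 𝓘(ℝ, E2) p ≃L[ℝ] E2 := (mdifferentiable_chart_of_mem hc).mfderiv hp
  let T' : TangentSpace 𝓘(ℝ, E2) p ≃L[ℝ] E2 := (mdifferentiable_chart_of_mem hc').mfderiv hp'
  refine ⟨T.symm.trans T', fun y => ?_⟩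
  have h1 := ofCoord_coord hc (u := ⟨p, T.symm y⟩) hp
  have h2 := ofCoord_coord hc' (u := ⟨p, T.symm y⟩) hp'
  have h3 : fibreCoord c (⟨p, T.symm y⟩ : TangentBundle 𝓘(ℝ, E2) M) = y := T.apply_symm_apply y
  rw [h3] at h1
  exact h1.trans h2.symm

variable [IsManifold 𝓘(ℝ, E2) ∞ M]

lemma contMDiffOn_ofCoord (hc : c ∈ IsManifold.maximalAtlas 𝓘(ℝ, E2) ∞ M) :
    ContMDiffOn 𝓘(ℝ, E2 × E2) 𝓘(ℝ, E2).tangent ∞ (fun z : E2 × E2 => ofCoord c z.1 z.2)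
      (c.target ×ˢ Set.univ) := by
  have : IsManifold 𝓘(ℝ, E2) 1 M := IsManifold.of_le (n := ∞) (by simp)
  have h1 := (contMDiffOn_symm_of_mem_maximalAtlas hc).contMDiffOn_tangentMapWithin
    (m := ∞) (by simp) c.open_target.uniqueMDiffOn
  have h3 : ContMDiffOn 𝓘(ℝ, E2 × E2) 𝓘(ℝ, E2).tangent ∞
      (fun z : E2 × E2 => tangentMapWithin 𝓘(ℝ, E2) 𝓘(ℝ, E2) c.symm c.target
        (⟨z.1, z.2⟩ : TangentBundle 𝓘(ℝ, E2) E2)) (c.target ×ˢ Set.univ) :=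
    ContMDiffOn.comp (t := Bundle.TotalSpace.proj ⁻¹' c.target) h1
      (contMDiff_modelTangent.contMDiffOn (s := c.target ×ˢ Set.univ)) fun z hz => hz.1
  refine h3.congr fun z hz => ?_
  have hm : MDifferentiableAt 𝓘(ℝ, E2) 𝓘(ℝ, E2) c.symm z.1 :=
    ((contMDiffOn_symm_of_mem_maximalAtlas hc).contMDiffAt
      (c.open_target.mem_nhds hz.1)).mdifferentiableAt (by simp)
  exact (tangentMapWithin_eq_tangentMap (p := (⟨z.1, z.2⟩ : TangentBundle 𝓘(ℝ, E2) E2))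
    (c.open_target.uniqueMDiffOn z.1 hz.1) hm).symm

lemma continuousOn_coord (hc : c ∈ IsManifold.maximalAtlas 𝓘(ℝ, E2) ∞ M) :
    ContinuousOn (fun u : TangentBundle 𝓘(ℝ, E2) M => (baseCoord c u, fibreCoord c u))
      (Bundle.TotalSpace.proj ⁻¹' c.source) := by
  have : IsManifold 𝓘(ℝ, E2) 1 M := IsManifold.of_le (n := ∞) (by simp)
  have h1 := (contMDiffOn_of_mem_maximalAtlas hc).continuousOn_tangentMapWithin
    (by simp) c.open_source.uniqueMDiffOn
  have h2 := (tangentBundleModelSpaceHomeomorph 𝓘(ℝ, E2)).continuous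
  refine (h2.comp_continuousOn h1).congr fun u hu => ?_
  simp only [Function.comp]
  rw [tangentMapWithin_eq_tangentMap (c.open_source.uniqueMDiffOn _ hu)
    ((contMDiffOn_of_mem_maximalAtlas hc).contMDiffAt
        (c.open_source.mem_nhds hu) |>.mdifferentiableAt (by simp))]
  rfl

lemma isOpen_proj_source (c : OpenPartialHomeomorph M E2) :
    IsOpen (Bundle.TotalSpace.proj ⁻¹' c.source : Set (TangentBundle 𝓘(ℝ, E2) M)) := by
  have : IsManifold 𝓘(ℝ, E2) 1 M := IsManifold.of_le (n := ∞) (by simp)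
  exact c.open_source.preimage (FiberBundle.continuous_proj E2 (TangentSpace 𝓘(ℝ, E2)))

lemma isOpen_coordSet (hc : c ∈ IsManifold.maximalAtlas 𝓘(ℝ, E2) ∞ M) (hA : IsOpen A) :
    IsOpen (coordSet c A) := by
  have := (contMDiffOn_ofCoord hc).continuousOn.isOpen_inter_preimage
    (c.open_target.prod isOpen_univ) hA
  convert this using 1
  ext z; simp [coordSet]

lemma sm_inChart (hc : c ∈ IsManifold.maximalAtlas 𝓘(ℝ, E2) ∞ M) (hf : IsSmoothOn A f) :
    Sm (coordSet c A) (inChart c f) := by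
  have h1 := (contMDiffOn_ofCoord hc).mono (t := coordSet c A) fun z hz => ⟨hz.1, trivial⟩
  exact (ContMDiffOn.comp hf h1 fun z hz => hz.2).contDiffOn

end Coordinates

/-! ### Horizontal transport -/

section Transport

lemma eq_left_of_hasDerivWithinAt_zero {E : Type*} [NormedAddCommGroup E] [NormedSpace ℝ E]
    {f : ℝ → E} {a b : ℝ} (hf : ∀ t ∈ Set.Icc a b, HasDerivWithinAt f 0 (Set.Icc a b) t) :
    ∀ t ∈ Set.Icc a b, f t = f a :=
  constant_of_derivWithin_zero (fun t ht => (hf t ht).differentiableWithinAt) fun t ht =>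
    (hf t ⟨ht.1, ht.2.le⟩).derivWithin
      (uniqueDiffOn_Icc (ht.1.trans_lt ht.2) t ⟨ht.1, ht.2.le⟩)

namespace CoordChange

variable {Ω : Set (E2 × E2)} {F φ : E2 → E2 → ℝ} {x y : E2} (C : CoordChange Ω F φ)
include C

/-- Along a horizontal curve the scalar governing the `T`-tensor is stationary. -/
lemma hasDerivWithinAt_tScalar {α β : ℝ → E2} {x' y' : E2} {s : Set ℝ} {t : ℝ}
    (h : (α t, β t) ∈ Ω) (hα : HasDerivWithinAt α x' s t) (hβ : HasDerivWithinAt β y' s t)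
    (hy : ∀ j, y' j = -∑ i, barthel F j i (α t) (β t) * x' i) :
    HasDerivWithinAt (fun t => tScalar φ F (α t) (β t)) 0 s t := by
  have h1 := (C.smooth_tScalar.differentiableAt C.isOpen h).hasFDerivAt
  have h2 := h1.comp_hasDerivWithinAt (f := fun t => (α t, β t)) t (hα.prodMk hβ)
  have h3 := D_eq_sum C.isOpen C.smooth_tScalar h (x', y')
  have d0 := C.delta_tScalar h 0
  have d1 := C.delta_tScalar h 1
  have h4 : D (x', y') (tScalar φ F) (α t) (β t) = 0 := by
    rw [h3]
    simp only [delta, hy, Fin.sum_univ_two] at *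
    linear_combination x' 0 * d0 + x' 1 * d1
  rw [D] at h4
  rw [h4] at h2
  exact h2

lemma smooth_barthel (j i : Fin 2) : Sm Ω (barthel F j i) :=
  (Sm.sum fun l => (C.smooth_christoffel j i l).mul (sm_coord l)).congr fun _ _ h =>
    C.barthel_eq h j i

/-- Horizontal lifts of short segments exist, start anywhere near a given point, and stay near it.
They are found as integral curves of `(x, y, v) ↦ (v, -Gʲᵢ(x, y) vⁱ, 0)`. -/
lemma exists_tScalar_eq {x₀ y₀ : E2} {r : ℝ} (hr : 0 < r)
    (hΩ : Metric.ball x₀ r ×ˢ Metric.ball y₀ r ⊆ Ω) :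
    ∃ s > 0, s ≤ r ∧ ∀ x₁ ∈ Metric.ball x₀ s, ∀ y₁ ∈ Metric.ball y₀ s, ∀ x ∈ Metric.ball x₀ s,
      ∃ y ∈ Metric.ball y₀ r, tScalar φ F x y = tScalar φ F x₁ y₁ := by
  set V : E2 × E2 × E2 → E2 × E2 × E2 := fun z =>
    (z.2.2, WithLp.toLp 2 (fun j => -∑ i, barthel F j i z.1 z.2.1 * z.2.2 i), 0) with hV
  have h0 : (x₀, y₀) ∈ Ω := hΩ ⟨Metric.mem_ball_self hr, Metric.mem_ball_self hr⟩
  have hVs : ContDiffAt ℝ 1 V (x₀, y₀, 0) := by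
    have hb : ∀ j i, ContDiffAt ℝ 1 (fun z : E2 × E2 × E2 => barthel F j i z.1 z.2.1)
        (x₀, y₀, 0) := fun j i => by
      have h1 : ContDiffAt ℝ 1 (fun z : E2 × E2 => barthel F j i z.1 z.2) (x₀, y₀) :=
        ((C.smooth_barthel j i).contDiffAt (C.isOpen.mem_nhds h0)).of_le (by simp)
      exact ContDiffAt.comp (g := fun z : E2 × E2 => barthel F j i z.1 z.2)
        (f := fun z : E2 × E2 × E2 => (z.1, z.2.1)) (x₀, y₀, (0 : E2)) h1
        (contDiff_fst.prodMk (contDiff_fst.comp contDiff_snd)).contDiffAt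
    have hv : ∀ i, ContDiffAt ℝ 1 (fun z : E2 × E2 × E2 => z.2.2 i) (x₀, y₀, 0) := fun i =>
      ((contDiff_piLp_apply (𝕜 := ℝ) (p := 2)).comp
        (contDiff_snd.comp contDiff_snd)).contDiffAt
    refine ((contDiff_snd.comp contDiff_snd).contDiffAt).prodMk (ContDiffAt.prodMk ?_
      contDiffAt_const)
    rw [contDiffAt_piLp]
    exact fun j => (ContDiffAt.sum fun i _ => (hb j i).mul (hv i)).neg
  obtain ⟨ε, hε, a, r', L, K, hr', hpl⟩ := IsPicardLindelof.of_contDiffAt_one hVs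
  obtain ⟨α, hα, hαc⟩ :=
    (hpl 0).exists_forall_mem_closedBall_eq_hasDerivWithinAt_continuousOn
  have hr'' : (0 : ℝ) < r' := hr'
  have hz0 : (x₀, y₀, (0 : E2)) ∈ Metric.closedBall (x₀, y₀, (0 : E2)) (r' : ℝ) :=
    Metric.mem_closedBall_self hr''.le
  have hc0 := hαc ((x₀, y₀, 0), 0) ⟨hz0, by constructor <;> linarith⟩
  rw [Metric.continuousWithinAt_iff] at hc0
  obtain ⟨δ, hδ, hδc⟩ := hc0 r hr
  have ha0 : α ((x₀, y₀, 0), 0) = (x₀, y₀, 0) := (hα _ hz0).1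
  rw [ha0] at hδc
  set ρ := min δ r' with hρ
  have hρ0 : 0 < ρ := lt_min hδ hr''
  set τ := min (δ / 2) ε with hτ
  have hτ0 : 0 < τ := lt_min (by positivity) hε
  have hτδ : τ < δ := (min_le_left _ _).trans_lt (by linarith)
  have hτε : τ ≤ ε := min_le_right _ _
  -- The velocity of a segment between points of the `s`-ball, run in time `τ`, is less than `ρ`.
  refine ⟨min (min ρ r) (τ * ρ / 2), by positivity, (min_le_left _ _).trans (min_le_right _ _), ?_⟩
  intro x₁ hx₁ y₁ hy₁ x hx
  simp only [Metric.mem_ball, lt_min_iff] at hx₁ hy₁ hx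
  set v : E2 := τ⁻¹ • (x - x₁) with hv
  have hvn : ‖v‖ < ρ := by
    rw [hv, norm_smul, norm_inv, Real.norm_of_nonneg hτ0.le, inv_mul_lt_iff₀ hτ0, ← dist_eq_norm]
    have := dist_triangle_right x x₁ x₀
    linarith [hx.2, hx₁.2]
  set z : E2 × E2 × E2 := (x₁, y₁, v) with hz
  have hzd : dist z (x₀, y₀, 0) < ρ := by
    simp only [hz, Prod.dist_eq, max_lt_iff, dist_zero_right]
    exact ⟨hx₁.1.1, hy₁.1.1, hvn⟩
  have hzr : z ∈ Metric.closedBall (x₀, y₀, (0 : E2)) (r' : ℝ) :=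
    (hzd.trans_le (min_le_right _ _)).le
  obtain ⟨hi, hd⟩ := hα z hzr
  have hsub : Set.Icc 0 τ ⊆ Set.Icc (0 - ε) (0 + ε) := Set.Icc_subset_Icc (by linarith) (by linarith)
  have hd' : ∀ t ∈ Set.Icc 0 τ, HasDerivWithinAt (fun t => α (z, t)) (V (α (z, t))) (Set.Icc 0 τ) t :=
    fun t ht => (hd t (hsub ht)).mono hsub
  have hnear : ∀ t ∈ Set.Icc 0 τ, dist (α (z, t)) (x₀, y₀, 0) < r := fun t ht => by
    refine hδc ⟨hzr, hsub ht⟩ ?_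
    rw [Prod.dist_eq, max_lt_iff]
    refine ⟨hzd.trans_le (min_le_left _ _), ?_⟩
    rw [Real.dist_eq, sub_zero, abs_of_nonneg ht.1]
    exact ht.2.trans_lt hτδ
  have hmem : ∀ t ∈ Set.Icc 0 τ, (α (z, t)).1 ∈ Metric.ball x₀ r ∧
      (α (z, t)).2.1 ∈ Metric.ball y₀ r := fun t ht => by
    have := hnear t ht
    simp only [Prod.dist_eq, max_lt_iff] at this
    exact ⟨this.1, this.2.1⟩
  have hi0 : α (z, 0) = z := hi
  have d1 := fun t ht => hasFDerivAt_fst.comp_hasDerivWithinAt t (hd' t ht)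
  have d2 := fun t ht => hasFDerivAt_snd.comp_hasDerivWithinAt t (hd' t ht)
  have d21 := fun t ht => hasFDerivAt_fst.comp_hasDerivWithinAt t (d2 t ht)
  have d22 := fun t ht => hasFDerivAt_snd.comp_hasDerivWithinAt t (d2 t ht)
  have hvel : ∀ t ∈ Set.Icc 0 τ, (α (z, t)).2.2 = v := fun t ht => by
    have := eq_left_of_hasDerivWithinAt_zero (f := fun t => (α (z, t)).2.2)
      (fun t ht => d22 t ht) t ht
    rw [this, hi0]
  have hpos : (α (z, τ)).1 = x := by
    have h1 : ∀ t ∈ Set.Icc 0 τ,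
        HasDerivWithinAt (fun t => (α (z, t)).1 - t • v) 0 (Set.Icc 0 τ) t := fun t ht => by
      have h2 : HasDerivWithinAt (fun t => (α (z, t)).1) v (Set.Icc 0 τ) t := by
        have := d1 t ht
        rw [← hvel t ht]
        exact this
      have h3 : HasDerivWithinAt (fun t : ℝ => t • v) ((1 : ℝ) • v) (Set.Icc 0 τ) t :=
        (hasDerivWithinAt_id t _).smul_const v
      have h4 := h2.sub h3
      rw [one_smul, sub_self] at h4
      exact h4
    have h2 := eq_left_of_hasDerivWithinAt_zero h1 τ ⟨hτ0.le, le_rfl⟩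
    simp only [hi0, zero_smul, sub_zero] at h2
    rw [sub_eq_iff_eq_add.1 h2, hz, hv, smul_smul, mul_inv_cancel₀ hτ0.ne', one_smul]
    abel
  have hconst := eq_left_of_hasDerivWithinAt_zero
    (f := fun t => tScalar φ F (α (z, t)).1 (α (z, t)).2.1) (a := 0) (b := τ) (fun t ht =>
      C.hasDerivWithinAt_tScalar (α := fun t => (α (z, t)).1) (β := fun t => (α (z, t)).2.1)
        (hΩ ⟨(hmem t ht).1, (hmem t ht).2⟩) (d1 t ht) (d21 t ht) (fun j => by simp [hV]))
      τ ⟨hτ0.le, le_rfl⟩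
  refine ⟨(α (z, τ)).2.1, (hmem τ ⟨hτ0.le, le_rfl⟩).2, ?_⟩
  simp only [hi0, hpos] at hconst
  exact hconst

end CoordChange
end Transport

/-! ### Anisotropic conformal changes on surfaces -/

section Surface

variable {M : Type*} [TopologicalSpace M] [ChartedSpace E2 M] [IsManifold 𝓘(ℝ, E2) ∞ M]
  {A : Set (TangentBundle 𝓘(ℝ, E2) M)} {F φ : TangentBundle 𝓘(ℝ, E2) M → ℝ}
  {c : OpenPartialHomeomorph M E2}

/-- The scalar governing the `T`-tensor of `e^φ F`, as a function on the tangent bundle, computed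
in the preferred chart at each point. -/
def tFun (φ F : TangentBundle 𝓘(ℝ, E2) M → ℝ) (u : TangentBundle 𝓘(ℝ, E2) M) : ℝ :=
  tScalar (inChart (chartAt E2 u.proj) φ) (inChart (chartAt E2 u.proj) F)
    (baseCoord (chartAt E2 u.proj) u) (fibreCoord (chartAt E2 u.proj) u)

/-- A conic pseudo-Riemannian metric on a surface and an anisotropic conformal factor whose
derivative `φ_{;2}` is horizontally constant. -/
structure ChangeData (A : Set (TangentBundle 𝓘(ℝ, E2) M))
    (F φ : TangentBundle 𝓘(ℝ, E2) M → ℝ) : Prop where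
  metric : IsConicPseudoRiemannian A F
  factor : IsAnisotropicConformalFactor A F φ
  const : VDer2HorizontallyConstant A F φ

namespace ChangeData

variable (H : ChangeData A F φ)
include H

lemma coordChange (hc : c ∈ IsManifold.maximalAtlas 𝓘(ℝ, E2) ∞ M) :
    CoordChange (coordSet c A) (inChart c F) (inChart c φ) where
  isOpen := isOpen_coordSet hc H.metric.conic.isOpen
  smooth := sm_inChart hc H.metric.smooth
  hom x y h t ht := by
    have := H.metric.homogeneous _ h.2 t ht
    rw [← ofCoord_smul] at this
    exact this
  det_ne x y h := H.metric.nondegenerate _ h.2 c hc x h.1 y rfl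
  cartan x y h := H.metric.cartan_eq_zero _ h.2 c hc x h.1 y rfl
  smooth_factor := sm_inChart hc H.factor.smooth
  hom_factor x y h t ht := by
    have := H.factor.homogeneous _ h.2 t ht
    rw [← ofCoord_smul] at this
    exact this
  nondegenerate x y h := H.factor.nondegenerate _ h.2 c hc x h.1 y rfl
  delta_vDer2 x y h := H.const _ h.2 c hc x h.1 y rfl

/-- The scalar governing the `T`-tensor does not depend on the chart. -/
lemma tFun_ofCoord (hc : c ∈ IsManifold.maximalAtlas 𝓘(ℝ, E2) ∞ M) {x y : E2}
    (h : (x, y) ∈ coordSet c A) :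
    tFun φ F (ofCoord c x y) = tScalar (inChart c φ) (inChart c F) x y := by
  set p : M := (ofCoord c x y).proj with hp
  have hpc : p ∈ c.source := proj_ofCoord_mem h.1 y
  have hcp : c p = x := c.right_inv h.1
  have hc' : chartAt E2 p ∈ IsManifold.maximalAtlas 𝓘(ℝ, E2) ∞ M :=
    IsManifold.chart_mem_maximalAtlas p
  have hp' : p ∈ (chartAt E2 p).source := mem_chart_source E2 p
  obtain ⟨L, hL⟩ := exists_fibreChange hc hc' hpc hp'
  rw [hcp] at hL
  have hx' : chartAt E2 p p ∈ (chartAt E2 p).target := (chartAt E2 p).map_source hp'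
  have hmem : (chartAt E2 p p, L y) ∈ coordSet (chartAt E2 p) A := ⟨hx', by
    have := h.2
    simp only [hL] at this
    exact this⟩
  have h1 := tScalar_fibreChange (F := inChart c F) (φ := inChart c φ) (x := x) (y := y)
    (H.coordChange hc') L (fun y => congrArg F (hL y)) (fun y => congrArg φ (hL y)) hmem
  rw [h1, tFun]
  have h2 : fibreCoord (chartAt E2 p) (ofCoord c x y) = L y := by
    rw [hL, fibreCoord_ofCoord hc' hx']
  rw [← hp, h2]
  rfl

lemma tFun_eq (hc : c ∈ IsManifold.maximalAtlas 𝓘(ℝ, E2) ∞ M)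
    {u : TangentBundle 𝓘(ℝ, E2) M} (hu : u ∈ A) (hp : u.proj ∈ c.source) :
    tFun φ F u = tScalar (inChart c φ) (inChart c F) (baseCoord c u) (fibreCoord c u) := by
  rw [← H.tFun_ofCoord hc (coord_mem hc hu hp), ofCoord_coord hc hp]

lemma tTensorVanishesOn {B : Set (TangentBundle 𝓘(ℝ, E2) M)} (hB : B ⊆ A)
    (h0 : ∀ u ∈ B, tFun φ F u = 0) : TTensorVanishesOn B (conformalChange φ F) := by
  intro u hu c hc x hx y hxy
  have h : (x, y) ∈ coordSet c A := ⟨hx, by rw [hxy]; exact hB hu⟩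
  refine ((H.coordChange hc).tTensor_iff
    (fibreCoord_ne_zero hxy (H.metric.conic.ne_zero u (hB hu))) h).2 ?_
  rw [← H.tFun_ofCoord hc h, hxy, h0 u hu]

/-- Either alternative makes the Landsberg scalar vanish. -/
lemma landsbergScalar_eq_zero {B : Set (TangentBundle 𝓘(ℝ, E2) M)}
    (hB : TTensorVanishesOn B (conformalChange φ F) ∨ ScalarDerivRelationOn B F φ)
    {u : TangentBundle 𝓘(ℝ, E2) M} (huA : u ∈ A) (huB : u ∈ B) :
    HoldsAt u fun c x y => landsbergScalar (inChart c (conformalChange φ F)) x y = 0 := by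
  intro c hc x hx y hxy
  have h : (x, y) ∈ coordSet c A := ⟨hx, by rw [hxy]; exact huA⟩
  have C := H.coordChange hc
  refine (C.landsberg_iff h).2 ?_
  rcases hB with hB | hB
  · exact Or.inl ((C.tTensor_iff (fibreCoord_ne_zero hxy (H.metric.conic.ne_zero u huA)) h).1
      (hB u huB c hc x hx y hxy))
  · exact Or.inr ((C.relation_iff h).1 (hB u huB c hc x hx y hxy))

/-- If `e^φ F` is Landsberg and its `T`-tensor does not vanish somewhere on a connected open part
of a fibre, then `φ` is horizontally constant on that part, since `δᵢφ` is constant along it. -/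
lemma relation_of_tFun_ne_zero (hL : IsLandsberg A (conformalChange φ F)) {p : M}
    {S : Set (TangentSpace 𝓘(ℝ, E2) p)} (hSo : IsOpen S) (hSc : IsPreconnected S)
    (hSA : ∀ v ∈ S, (⟨p, v⟩ : TangentBundle 𝓘(ℝ, E2) M) ∈ A) {v₀ : TangentSpace 𝓘(ℝ, E2) p}
    (hv₀ : v₀ ∈ S) (h0 : tFun φ F ⟨p, v₀⟩ ≠ 0) {v : TangentSpace 𝓘(ℝ, E2) p} (hv : v ∈ S) :
    HoldsAt (⟨p, v⟩ : TangentBundle 𝓘(ℝ, E2) M) fun c x y =>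
      vDer2 (inChart c F) (inChart c φ) x y * hDer1 (inChart c F) (inChart c φ) x y
        = hDer2 (inChart c F) (inChart c φ) x y := by
  intro c hc x hx y hxy
  have C := H.coordChange hc
  have hpc : p ∈ c.source := by
    have := proj_ofCoord_mem (c := c) hx y
    rwa [hxy] at this
  let T : TangentSpace 𝓘(ℝ, E2) p ≃L[ℝ] E2 := (mdifferentiable_chart_of_mem hc).mfderiv hpc
  have hT : ∀ w, fibreCoord c (⟨p, w⟩ : TangentBundle 𝓘(ℝ, E2) M) = T w := fun w => rfl
  have hx' : c p = x := by
    have := baseCoord_ofCoord (c := c) hx y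
    rwa [hxy] at this
  have hy' : T v = y := by
    have := fibreCoord_ofCoord hc hx y
    rwa [hxy] at this
  have hmem : ∀ w ∈ S, (x, T w) ∈ coordSet c A := fun w hw => by
    have := coord_mem hc (hSA w hw) hpc
    rw [hT] at this
    rw [← hx']
    exact this
  have hxy' : (x, y) ∈ coordSet c A := by rw [← hy']; exact hmem v hv
  set S' : Set E2 := T '' S with hS'
  have hS'o : IsOpen S' := T.toHomeomorph.isOpenMap S hSo
  have hS'c : IsPreconnected S' := hSc.image T T.continuous.continuousOn
  refine (C.relation_iff hxy').2 (defect_eq_zero fun k => ?_)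
  -- Near `v₀` the scalar of the `T`-tensor does not vanish, so the other factor has to.
  have hzero : delta (inChart c F) k (inChart c φ) x (T v₀) = 0 := by
    set Ω' := coordSet c A ∩ (fun z : E2 × E2 =>
      tScalar (inChart c φ) (inChart c F) z.1 z.2) ⁻¹' {0}ᶜ
    have hΩ' : IsOpen Ω' :=
      C.smooth_tScalar.continuousOn.isOpen_inter_preimage C.isOpen isOpen_compl_singleton
    refine C.delta_factor_eq_zero hΩ' Set.inter_subset_left ?_ (x := x) (y := T v₀)
      ⟨hmem v₀ hv₀, ?_⟩ k
    · intro x y h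
      exact ((C.landsberg_iff h.1).1 (hL _ h.1.2 c hc x h.1.1 y rfl)).resolve_left h.2
    · have h1 := H.tFun_eq hc (hSA v₀ hv₀) hpc
      rw [hT] at h1
      rw [h1] at h0
      rw [← hx']
      exact h0
  have hs := C.smooth_delta_factor k
  have hdiff : ∀ w ∈ S', DifferentiableAt ℝ (delta (inChart c F) k (inChart c φ) x) w := by
    rintro w ⟨w', hw', rfl⟩
    exact DifferentiableAt.comp (g := fun z : E2 × E2 => delta (inChart c F) k (inChart c φ) z.1 z.2)
      (T w') (hs.differentiableAt C.isOpen (hmem w' hw'))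
      ((differentiableAt_const x).prodMk differentiableAt_id)
  have hfd : S'.EqOn (fderiv ℝ (delta (inChart c F) k (inChart c φ) x)) 0 := by
    rintro w ⟨w', hw', rfl⟩
    ext v
    rw [sum_e v, map_sum]
    refine (Finset.sum_eq_zero fun i _ => ?_).trans (by simp)
    rw [map_smul]
    have := C.vConst_delta_factor k x (T w') (hmem w' hw') i
    rw [dy] at this
    rw [this, smul_zero]
  have := hS'o.is_const_of_fderiv_eq_zero hS'c
    (fun w hw => (hdiff w hw).differentiableWithinAt) hfd
    (Set.mem_image_of_mem T hv) (Set.mem_image_of_mem T hv₀)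
  rw [← hy', this, hzero]

/-- The scalar governing the `T`-tensor is constant along horizontal curves. -/
lemma tFun_horizontal {γ : ℝ → TangentBundle 𝓘(ℝ, E2) M} (hγ : IsHorizontalCurve F γ)
    (hγA : ∀ t ∈ Set.Icc (0 : ℝ) 1, γ t ∈ A) : tFun φ F (γ 1) = tFun φ F (γ 0) := by
  refine eq_left_of_hasDerivWithinAt_zero (f := fun t => tFun φ F (γ t)) (a := 0) (b := 1) ?_ 1
    ⟨zero_le_one, le_rfl⟩
  intro t ht
  set c := chartAt E2 (γ t).proj with hcdef
  have hc : c ∈ IsManifold.maximalAtlas 𝓘(ℝ, E2) ∞ M := IsManifold.chart_mem_maximalAtlas _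
  have hp : (γ t).proj ∈ c.source := mem_chart_source E2 _
  obtain ⟨x', y', hx', hy', h⟩ := hγ.2 t ht c hc hp
  have h1 := (H.coordChange hc).hasDerivWithinAt_tScalar (coord_mem hc (hγA t ht) hp)
    hx' hy' h
  refine h1.congr_of_eventuallyEq ?_ (H.tFun_eq hc (hγA t ht) hp)
  have h2 := (hγ.1 t ht).preimage_mem_nhdsWithin ((isOpen_proj_source c).mem_nhds hp)
  filter_upwards [h2, self_mem_nhdsWithin] with s hs hs'
  exact H.tFun_eq hc (hγA s hs') hs

/-- Near every point of `A` the `T`-tensor vanishes or the relation holds. -/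
lemma exists_nhd (hL : IsLandsberg A (conformalChange φ F)) {u : TangentBundle 𝓘(ℝ, E2) M}
    (hu : u ∈ A) : ∃ B : Set (TangentBundle 𝓘(ℝ, E2) M), IsOpen B ∧ u ∈ B ∧ B ⊆ A ∧
      (TTensorVanishesOn B (conformalChange φ F) ∨ ScalarDerivRelationOn B F φ) := by
  by_cases hz : ∃ O : Set (TangentBundle 𝓘(ℝ, E2) M), IsOpen O ∧ u ∈ O ∧
      ∀ v ∈ O ∩ A, tFun φ F v = 0
  · obtain ⟨O, hO, huO, hO0⟩ := hz
    exact ⟨O ∩ A, hO.inter H.metric.conic.isOpen, ⟨huO, hu⟩, Set.inter_subset_right,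
      Or.inl (H.tTensorVanishesOn Set.inter_subset_right hO0)⟩
  push Not at hz
  set c := chartAt E2 u.proj with hcdef
  have hc : c ∈ IsManifold.maximalAtlas 𝓘(ℝ, E2) ∞ M := IsManifold.chart_mem_maximalAtlas _
  have hp : u.proj ∈ c.source := mem_chart_source E2 _
  have C := H.coordChange hc
  set x₀ := baseCoord c u
  set y₀ := fibreCoord c u
  obtain ⟨r, hr, hrΩ⟩ : ∃ r > 0, Metric.ball x₀ r ×ˢ Metric.ball y₀ r ⊆ coordSet c A := by
    obtain ⟨r, hr, h⟩ := Metric.isOpen_iff.1 C.isOpen _ (coord_mem hc hu hp)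
    exact ⟨r, hr, by rwa [ball_prod_same]⟩
  obtain ⟨s, hs, hsr, hspread⟩ := C.exists_tScalar_eq hr hrΩ
  set Z : TangentBundle 𝓘(ℝ, E2) M → E2 × E2 := fun w => (baseCoord c w, fibreCoord c w)
  have hopen : ∀ s r : ℝ, IsOpen (Bundle.TotalSpace.proj ⁻¹' c.source ∩
      Z ⁻¹' (Metric.ball x₀ s ×ˢ Metric.ball y₀ r)) := fun s r =>
    (continuousOn_coord hc).isOpen_inter_preimage (isOpen_proj_source c)
      (Metric.isOpen_ball.prod Metric.isOpen_ball)
  obtain ⟨v, ⟨⟨hvp, hv⟩, hvA⟩, hv0⟩ := hz _ (hopen s s)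
    ⟨hp, Metric.mem_ball_self hs, Metric.mem_ball_self hs⟩
  have hBA : (Bundle.TotalSpace.proj ⁻¹' c.source ∩
      Z ⁻¹' (Metric.ball x₀ s ×ˢ Metric.ball y₀ r)) ⊆ A := fun w hw => by
    have h1 := (hrΩ ⟨Metric.ball_subset_ball hsr hw.2.1, hw.2.2⟩).2
    rwa [ofCoord_coord hc hw.1] at h1
  refine ⟨_, hopen s r, ⟨hp, Metric.mem_ball_self hs, Metric.mem_ball_self hr⟩, hBA,
    Or.inr ?_⟩
  rintro ⟨p, w⟩ ⟨hwp, hw⟩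
  let T : TangentSpace 𝓘(ℝ, E2) p ≃L[ℝ] E2 := (mdifferentiable_chart_of_mem hc).mfderiv hwp
  obtain ⟨y₂, hy₂, hy₂'⟩ := hspread _ hv.1 _ hv.2 _ hw.1
  have hTy : ∀ y, ofCoord c (c p) y = ⟨p, T.symm y⟩ := fun y => by
    have h1 := ofCoord_coord hc (u := ⟨p, T.symm y⟩) hwp
    have h2 : fibreCoord c (⟨p, T.symm y⟩ : TangentBundle 𝓘(ℝ, E2) M) = y := T.apply_symm_apply y
    rw [h2] at h1
    exact h1
  have hxb : c p ∈ Metric.ball x₀ r := Metric.ball_subset_ball hsr hw.1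
  refine H.relation_of_tFun_ne_zero hL (p := p) (S := T ⁻¹' Metric.ball y₀ r)
    (Metric.isOpen_ball.preimage T.continuous) ?_ ?_ (v₀ := T.symm y₂) ?_ ?_ hw.2
  · rw [← T.image_symm_eq_preimage]
    exact (convex_ball y₀ r).isPreconnected.image _ T.symm.continuous.continuousOn
  · intro v' hv'
    have h1 := (hrΩ (a := (c p, T v')) ⟨hxb, hv'⟩).2
    simp only [hTy, T.symm_apply_apply] at h1
    exact h1
  · simpa using hy₂
  · have hm : (c p, y₂) ∈ coordSet c A := hrΩ ⟨hxb, hy₂⟩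
    have h1 := H.tFun_ofCoord hc hm
    rw [← hTy, h1]
    refine fun h2 => hv0 ?_
    rw [H.tFun_eq hc hvA hvp]
    exact hy₂'.symm.trans h2

lemma isLandsberg_iff : IsLandsberg A (conformalChange φ F) ↔
    ∀ u ∈ A, ∃ B : Set (TangentBundle 𝓘(ℝ, E2) M), IsOpen B ∧ u ∈ B ∧ B ⊆ A ∧
      (TTensorVanishesOn B (conformalChange φ F) ∨ ScalarDerivRelationOn B F φ) := by
  refine ⟨fun hL u hu => H.exists_nhd hL hu, fun h u hu => ?_⟩
  obtain ⟨B, -, huB, -, hB⟩ := h u hu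
  exact H.landsbergScalar_eq_zero hB hu huB

lemma isLandsberg_iff_of_connected (hA : IsHorizontallyConnected A F) :
    IsLandsberg A (conformalChange φ F) ↔
      (TTensorVanishesOn A (conformalChange φ F) ∨ ScalarDerivRelationOn A F φ) := by
  refine ⟨fun hL => ?_, fun h u hu => H.landsbergScalar_eq_zero h hu hu⟩
  by_cases h0 : ∀ u ∈ A, tFun φ F u = 0
  · exact Or.inl (H.tTensorVanishesOn subset_rfl h0)
  push Not at h0
  obtain ⟨u, hu, hu0⟩ := h0
  right
  rintro ⟨p, w⟩ hw
  obtain ⟨γ, hγ, hγA, hγ0, hγ1⟩ := hA.2 u hu p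
  have h1 := H.tFun_horizontal hγ hγA
  rw [hγ0] at h1
  have hγ1A := hγA 1 ⟨zero_le_one, le_rfl⟩
  obtain ⟨v₀, hv₀⟩ : ∃ v₀ : TangentSpace 𝓘(ℝ, E2) p,
      γ 1 = (⟨p, v₀⟩ : TangentBundle 𝓘(ℝ, E2) M) := by
    subst hγ1
    exact ⟨(γ 1).2, rfl⟩
  rw [hv₀] at h1 hγ1A
  have : IsManifold 𝓘(ℝ, E2) 1 M := IsManifold.of_le (n := ∞) (by simp)
  refine H.relation_of_tFun_ne_zero hL (p := p)
    (S := {v | (⟨p, v⟩ : TangentBundle 𝓘(ℝ, E2) M) ∈ A}) ?_ (hA.1 p).isPreconnected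
    (fun v hv => hv) hγ1A (by rw [h1]; exact hu0) hw
  exact H.metric.conic.isOpen.preimage
    (FiberBundle.continuous_totalSpaceMk E2 (TangentSpace 𝓘(ℝ, E2)) p)

end ChangeData

end Surface

end FinslerSurface

end

theorem mainTheorem12 {M : Type*} [TopologicalSpace M] [ChartedSpace FinslerSurface.E2 M]
    [IsManifold 𝓘(ℝ, FinslerSurface.E2) ∞ M]
    (A : Set (TangentBundle 𝓘(ℝ, FinslerSurface.E2) M))
    (F φ : TangentBundle 𝓘(ℝ, FinslerSurface.E2) M → ℝ)
    (hF : FinslerSurface.IsConicPseudoRiemannian A F)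
    (hφ : FinslerSurface.IsAnisotropicConformalFactor A F φ)
    (hconst : FinslerSurface.VDer2HorizontallyConstant A F φ) :
    (FinslerSurface.IsLandsberg A (FinslerSurface.conformalChange φ F) ↔
      ∀ u ∈ A, ∃ B : Set (TangentBundle 𝓘(ℝ, FinslerSurface.E2) M),
        IsOpen B ∧ u ∈ B ∧ B ⊆ A ∧
          (FinslerSurface.TTensorVanishesOn B (FinslerSurface.conformalChange φ F) ∨
            FinslerSurface.ScalarDerivRelationOn B F φ)) ∧
    (FinslerSurface.IsHorizontallyConnected A F →
      (FinslerSurface.IsLandsberg A (FinslerSurface.conformalChange φ F) ↔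
        (FinslerSurface.TTensorVanishesOn A (FinslerSurface.conformalChange φ F) ∨
          FinslerSurface.ScalarDerivRelationOn A F φ))) := by
  have H : FinslerSurface.ChangeData A F φ := ⟨hF, hφ, hconst⟩
  exact ⟨H.isLandsberg_iff, H.isLandsberg_iff_of_connected⟩
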